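/- Let $0<q<1$. Let $\mathcal A(\mathrm{SU}_q(2))$ be the unital $*$-algebra generated by $a,c$ with relations $ac=qca$, $ac^*=qc^*a$, $cc^*=c^*c$, $a^*a+c^*c=aa^*+q^2cc^*=1$, with Haar state $h$: on the basis of monomials $a^kc^ic^{*j}$ ($k\ge0$), $a^{*k}c^ic^{*j}$ ($k\ge1$), $i,j\ge0$, one has $h((cc^*)^i)=(1+q^2+\dots+q^{2i})^{-1}$, and $h$ vanishes on all other basis monomials. Let $K^{\pm1},E,F$ generate $U_q(su(2))$, acting on $\mathcal A(\mathrm{SU}_q(2))$ from the left ($\Delta K=K\otimes K$, $\Delta E=E\otimes K+K^{-1}\otimes E$, $\Delta F=F\otimes K+K^{-1}\otimes F$) by $K\triangleright(a,c,a^*,c^*)=(q^{-1/2}a,q^{-1/2}c,q^{1/2}a^*,q^{1/2}c^*)$, $E\triangleright(a,c,a^*,c^*)=(-qc^*,a^*,0,0)$, $F\triangleright(a,c,a^*,c^*)=(0,0,c,-q^{-1}a)$. The coordinate algebra of the standard Podleś sphere is $\mathcal A(S^2_q)=\{f\in\mathcal A(\mathrm{SU}_q(2)): K\triangleright f=f\}$.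 Let $\Omega(\mathrm{SU}_q(2))$ be Woronowicz's exterior algebra of the $4D_+$ bicovariant calculus: with the ordering $(-,z,+,0)$, $\Omega^1(\mathrm{SU}_q(2))$ is the free left module on the left invariant one-forms $\omega_-,\omega_z,\omega_+,\omega_0$, with right module structure $\omega_b\,x=\sum_d(f_{bd}\triangleright x)\,\omega_d$, where $$(f_{bd})=\begin{pmatrix}1&0&0&q^{-1/2}KE\\(q-q^{-1})q^{1/2}FK^{-1}&K^{-2}&(q-q^{-1})q^{-1/2}EK^{-1}&(q-q^{-1})\big[FE+q^{-1}\tfrac{K^{-2}-K^2}{(q-q^{-1})^2}\big]\\0&0&1&q^{-1/2}FK\\0&0&0&K^2\end{pmatrix},$$ and with differential ${\rm d}x=\sum_b(L_b\triangleright x)\,\omega_b$, where $L_-=q^{1/2}FK^{-1}$, $L_z=\frac{K^{-2}-1}{q-q^{-1}}$, $L_+=q^{-1/2}EK^{-1}$, $L_0=\frac{q(K^2-1)+q^{-1}(K^{-2}-1)}{(q-q^{-1})^2}+FE$. Moreover $\Omega^k(\mathrm{SU}_q(2))=\Omega^1(\mathrm{SU}_q(2))^{\otimes k}/\ker\mathfrak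 A^{(k)}$ (tensor product over $\mathcal A(\mathrm{SU}_q(2))$), where $\mathfrak A^{(k)}=\sum_{\pi\in S_k}\mathrm{sgn}(\pi)\,\sigma_\pi$ is the antisymmetriser of the canonical braiding $\sigma$ of the calculus, the unique bimodule map on $\Omega^1\otimes\Omega^1$ with $\sigma(\omega\otimes\eta)=\eta\otimes\omega$ for $\omega$ a left invariant and $\eta$ a right invariant one-form. Let $\Omega(S^2_q)\subset\Omega(\mathrm{SU}_q(2))$ be the subalgebra generated by $\mathcal A(S^2_q)$ and ${\rm d}\mathcal A(S^2_q)$, let $\Omega^k(S^2_q)=\Omega(S^2_q)\cap\Omega^k(\mathrm{SU}_q(2))$, and let $\check\mu=\check m\,\omega_-\wedge\omega_+\wedge\omega_0$ with $\check m\in\mathbb R\setminus\{0\}$. Then $\Omega^3(S^2_q)=\mathcal A(S^2_q)\,\check\mu$, and there is exactly one linear functional $\int_{\check\mu}:\Omega(S^2_q)\to\mathbb C$ with $\int_{\check\mu}\theta=0$ for $\theta\in\Omega^k(S^2_q)$, $k=0,1,2$, and $\int_{\check\mu}f\check\mu=h(f)$ for $f\in\mathcal A(S^2_q)$. This integral is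 left-faithful: for $k=0,1,2,3$, if $\eta\in\Omega^k(S^2_q)$ satisfies $\int_{\check\mu}\eta'\wedge\eta=0$ for all $\eta'\in\Omega^{3-k}(S^2_q)$, then $\eta=0$. -/

import Mathlib

noncomputable section

namespace QSphere

/-! ## The coordinate algebra of the quantum group `SU_q(2)`, `0 < q < 1` -/

/-- The deformation parameter as a complex number. -/
def qc (q : Set.Ioo (0 : ℝ) 1) : ℂ := ((q : ℝ) : ℂ)

/-- The positive square root `q ^ (1/2)` of the deformation parameter, as a complex number. -/
def qh (q : Set.Ioo (0 : ℝ) 1) : ℂ := ((Real.sqrt (q : ℝ) : ℝ) : ℂ)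

theorem qc_ne_zero (q : Set.Ioo (0 : ℝ) 1) : qc q ≠ 0 := by
  have h := q.2.1
  simp only [qc, ne_eq, Complex.ofReal_eq_zero]
  exact h.ne'

theorem qh_sq (q : Set.Ioo (0 : ℝ) 1) : qh q * qh q = qc q := by
  simp only [qh, qc, ← Complex.ofReal_mul, Real.mul_self_sqrt q.2.1.le]

theorem qh_ne_zero (q : Set.Ioo (0 : ℝ) 1) : qh q ≠ 0 := by
  intro h
  apply qc_ne_zero q
  rw [← qh_sq, h, zero_mul]

/-- The generators `a`, `a^*`, `c`, `c^*`. -/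
inductive Gen
  | a | as | c | cs

/-- The defining relations of the algebra, together with their `*`-conjugates. -/
inductive SURel (q : Set.Ioo (0 : ℝ) 1) : FreeAlgebra ℂ Gen → FreeAlgebra ℂ Gen → Prop
  | a_c : SURel q (FreeAlgebra.ι ℂ Gen.a * FreeAlgebra.ι ℂ Gen.c)
      (qc q • (FreeAlgebra.ι ℂ Gen.c * FreeAlgebra.ι ℂ Gen.a))
  | a_cs : SURel q (FreeAlgebra.ι ℂ Gen.a * FreeAlgebra.ι ℂ Gen.cs)
      (qc q • (FreeAlgebra.ι ℂ Gen.cs * FreeAlgebra.ι ℂ Gen.a))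
  | cs_as : SURel q (FreeAlgebra.ι ℂ Gen.cs * FreeAlgebra.ι ℂ Gen.as)
      (qc q • (FreeAlgebra.ι ℂ Gen.as * FreeAlgebra.ι ℂ Gen.cs))
  | c_as : SURel q (FreeAlgebra.ι ℂ Gen.c * FreeAlgebra.ι ℂ Gen.as)
      (qc q • (FreeAlgebra.ι ℂ Gen.as * FreeAlgebra.ι ℂ Gen.c))
  | c_cs : SURel q (FreeAlgebra.ι ℂ Gen.c * FreeAlgebra.ι ℂ Gen.cs)
      (FreeAlgebra.ι ℂ Gen.cs * FreeAlgebra.ι ℂ Gen.c)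
  | as_a : SURel q (FreeAlgebra.ι ℂ Gen.as * FreeAlgebra.ι ℂ Gen.a
      + FreeAlgebra.ι ℂ Gen.cs * FreeAlgebra.ι ℂ Gen.c) 1
  | a_as : SURel q (FreeAlgebra.ι ℂ Gen.a * FreeAlgebra.ι ℂ Gen.as
      + qc q ^ 2 • (FreeAlgebra.ι ℂ Gen.c * FreeAlgebra.ι ℂ Gen.cs)) 1

/-- The coordinate algebra of `SU_q(2)`. -/
def SUq (q : Set.Ioo (0 : ℝ) 1) : Type := RingQuot (SURel q)

instance (q : Set.Ioo (0 : ℝ) 1) : Ring (SUq q) := inferInstanceAs (Ring (RingQuot (SURel q)))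

instance (q : Set.Ioo (0 : ℝ) 1) : Algebra ℂ (SUq q) :=
  inferInstanceAs (Algebra ℂ (RingQuot (SURel q)))

/-- The canonical projection from the free algebra. -/
def mk (q : Set.Ioo (0 : ℝ) 1) : FreeAlgebra ℂ Gen →ₐ[ℂ] SUq q := RingQuot.mkAlgHom ℂ (SURel q)

theorem mk_rel (q : Set.Ioo (0 : ℝ) 1) {x y : FreeAlgebra ℂ Gen} (h : SURel q x y) :
    mk q x = mk q y :=
  RingQuot.mkAlgHom_rel ℂ h

/-- The image in `SUq q` of a generator. -/
def gen (q : Set.Ioo (0 : ℝ) 1) (g : Gen) : SUq q := mk q (FreeAlgebra.ι ℂ g)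

/-- A map on the generators that respects the defining relations. -/
structure Respects (q : Set.Ioo (0 : ℝ) 1) {B : Type} [Ring B] [Algebra ℂ B] (φ : Gen → B) :
    Prop where
  a_c : φ .a * φ .c = qc q • (φ .c * φ .a)
  a_cs : φ .a * φ .cs = qc q • (φ .cs * φ .a)
  cs_as : φ .cs * φ .as = qc q • (φ .as * φ .cs)
  c_as : φ .c * φ .as = qc q • (φ .as * φ .c)
  c_cs : φ .c * φ .cs = φ .cs * φ .c
  as_a : φ .as * φ .a + φ .cs * φ .c = 1
  a_as : φ .a * φ .as + qc q ^ 2 • (φ .c * φ .cs) = 1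

theorem gen_respects (q : Set.Ioo (0 : ℝ) 1) : Respects q (gen q) := by
  constructor
  · simpa only [map_mul, map_smul, map_add, map_one, gen] using mk_rel q SURel.a_c
  · simpa only [map_mul, map_smul, map_add, map_one, gen] using mk_rel q SURel.a_cs
  · simpa only [map_mul, map_smul, map_add, map_one, gen] using mk_rel q SURel.cs_as
  · simpa only [map_mul, map_smul, map_add, map_one, gen] using mk_rel q SURel.c_as
  · simpa only [map_mul, map_smul, map_add, map_one, gen] using mk_rel q SURel.c_cs
  · simpa only [map_mul, map_smul, map_add, map_one, gen] using mk_rel q SURel.as_a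
  · simpa only [map_mul, map_smul, map_add, map_one, gen] using mk_rel q SURel.a_as

/-- The universal property of `SUq q`. -/
def lift (q : Set.Ioo (0 : ℝ) 1) {B : Type} [Ring B] [Algebra ℂ B] (φ : Gen → B)
    (h : Respects q φ) : SUq q →ₐ[ℂ] B :=
  RingQuot.liftAlgHom ℂ ⟨FreeAlgebra.lift ℂ φ, by
    intro x y hxy
    cases hxy
    · simpa using h.a_c
    · simpa using h.a_cs
    · simpa using h.cs_as
    · simpa using h.c_as
    · simpa using h.c_cs
    · simpa using h.as_a
    · simpa using h.a_as⟩

theorem lift_gen (q : Set.Ioo (0 : ℝ) 1) {B : Type} [Ring B] [Algebra ℂ B] (φ : Gen → B)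
    (h : Respects q φ) (g : Gen) : lift q φ h (gen q g) = φ g := by
  refine (RingQuot.liftAlgHom_mkAlgHom_apply ℂ (FreeAlgebra.lift ℂ φ) _
    (FreeAlgebra.ι ℂ g)).trans ?_
  simp

/-! ## The Haar state

The index `(k, i, j)` stands for the basis monomial `a ^ k c ^ i c^* ^ j` if `0 ≤ k` and for
`a^* ^ (-k) c ^ i c^* ^ j` if `k ≤ 0`.  The algebra acts by left multiplication on the space
spanned by these monomials, and `x` applied to the monomial `1` is the expansion of `x` in the
monomial basis. -/

/-- Left multiplication by a generator, in terms of the monomial basis. -/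
def monMul (q : Set.Ioo (0 : ℝ) 1) : Gen → Module.End ℂ ((ℤ × ℕ × ℕ) →₀ ℂ)
  | .a => Finsupp.linearCombination ℂ fun p =>
      if 0 ≤ p.1 then Finsupp.single (p.1 + 1, p.2.1, p.2.2) 1
      else Finsupp.single (p.1 + 1, p.2.1, p.2.2) 1
        - Finsupp.single (p.1 + 1, p.2.1 + 1, p.2.2 + 1) (qc q ^ (-2 * p.1))
  | .as => Finsupp.linearCombination ℂ fun p =>
      if p.1 ≤ 0 then Finsupp.single (p.1 - 1, p.2.1, p.2.2) 1
      else Finsupp.single (p.1 - 1, p.2.1, p.2.2) 1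
        - Finsupp.single (p.1 - 1, p.2.1 + 1, p.2.2 + 1) (qc q ^ (-2 * (p.1 - 1)))
  | .c => Finsupp.linearCombination ℂ fun p =>
      Finsupp.single (p.1, p.2.1 + 1, p.2.2) (qc q ^ (-p.1))
  | .cs => Finsupp.linearCombination ℂ fun p =>
      Finsupp.single (p.1, p.2.1, p.2.2 + 1) (qc q ^ (-p.1))

theorem monMul_respects (q : Set.Ioo (0 : ℝ) 1) : Respects q (monMul q) := by
  have h0 := qc_ne_zero q
  constructor
  all_goals
    apply Finsupp.lhom_ext'
    rintro ⟨k, i, j⟩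
    apply LinearMap.ext_ring
    simp only [LinearMap.comp_apply, Module.End.mul_apply, LinearMap.smul_apply,
      LinearMap.add_apply, Module.End.one_apply, Finsupp.lsingle_apply, monMul,
      Finsupp.linearCombination_single, one_smul]
  · rcases le_or_gt 0 k with hk | hk
    · simp only [hk, if_true, Finsupp.linearCombination_single, Finsupp.smul_single,
        smul_eq_mul]
      congr 1
      rw [neg_add, zpow_add₀ h0]; field_simp
    · simp only [not_le.2 hk, if_false, map_sub, Finsupp.linearCombination_single, Finsupp.smul_single,
        smul_eq_mul, smul_sub]
      congr 2 <;> (rw [neg_add, zpow_add₀ h0]; field_simp)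
  · rcases le_or_gt 0 k with hk | hk
    · simp only [hk, if_true, Finsupp.linearCombination_single, Finsupp.smul_single,
        smul_eq_mul]
      congr 1
      rw [neg_add, zpow_add₀ h0]; field_simp
    · simp only [not_le.2 hk, if_false, map_sub, Finsupp.linearCombination_single, Finsupp.smul_single,
        smul_eq_mul, smul_sub]
      congr 2 <;> (rw [neg_add, zpow_add₀ h0]; field_simp)
  · rcases le_or_gt k 0 with hk | hk
    · simp only [hk, if_true, Finsupp.linearCombination_single, Finsupp.smul_single,
        smul_eq_mul]
      congr 1
      rw [neg_sub, sub_eq_add_neg, zpow_add₀ h0]; field_simp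
    · simp only [not_le.2 hk, if_false, map_sub, Finsupp.linearCombination_single, Finsupp.smul_single,
        smul_eq_mul, smul_sub]
      congr 2 <;> (rw [neg_sub, sub_eq_add_neg 1 k, zpow_add₀ h0]; field_simp)
  · rcases le_or_gt k 0 with hk | hk
    · simp only [hk, if_true, Finsupp.linearCombination_single, Finsupp.smul_single,
        smul_eq_mul]
      congr 1
      rw [neg_sub, sub_eq_add_neg, zpow_add₀ h0]; field_simp
    · simp only [not_le.2 hk, if_false, map_sub, Finsupp.linearCombination_single, Finsupp.smul_single,
        smul_eq_mul, smul_sub]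
      congr 2 <;> (rw [neg_sub, sub_eq_add_neg 1 k, zpow_add₀ h0]; field_simp)
  · have e : qc q ^ (-2 * k) = qc q ^ (-k) * qc q ^ (-k) := by
      rw [← zpow_add₀ h0]; congr 1; ring
    rcases le_or_gt 0 k with hk | hk
    · have hk' : ¬ k + 1 ≤ 0 := by omega
      simp only [hk, hk', if_true, if_false, Finsupp.linearCombination_single, Finsupp.smul_single,
        smul_eq_mul,
        add_sub_cancel_right, one_smul]
      rw [e, sub_add_cancel]
    · have hk' : k + 1 ≤ 0 := by omega
      simp only [not_le.2 hk, hk', if_true, if_false, map_sub, Finsupp.linearCombination_single, Finsupp.smul_single,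
        smul_eq_mul,
        add_sub_cancel_right, mul_one, one_smul]
      rw [e, sub_add_cancel]
  · have e : qc q ^ (-2 * (k - 1)) = qc q ^ 2 * (qc q ^ (-k) * qc q ^ (-k)) := by
      rw [← zpow_natCast, ← zpow_add₀ h0, ← zpow_add₀ h0]; congr 1; push_cast; ring
    rcases le_or_gt k 0 with hk | hk
    · have hk' : ¬ 0 ≤ k - 1 := by omega
      simp only [hk, hk', if_true, if_false, Finsupp.linearCombination_single, Finsupp.smul_single,
        smul_eq_mul,
        sub_add_cancel, one_smul]
      rw [e, sub_add_cancel]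
    · have hk' : 0 ≤ k - 1 := by omega
      simp only [not_le.2 hk, hk', if_true, if_false, map_sub, Finsupp.linearCombination_single, Finsupp.smul_single,
        smul_eq_mul,
        sub_add_cancel, mul_one, one_smul]
      rw [e, sub_add_cancel]

/-- The expansion of an element of `SUq q` in the monomial basis. -/
def expand (q : Set.Ioo (0 : ℝ) 1) : SUq q →ₗ[ℂ] ((ℤ × ℕ × ℕ) →₀ ℂ) :=
  LinearMap.applyₗ (Finsupp.single (0, 0, 0) 1) ∘ₗ
    (lift q (monMul q) (monMul_respects q)).toLinearMap

/-- The value of the Haar state on the basis monomial with index `p`: it is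
`(1 + q ^ 2 + ⋯ + q ^ (2 i))⁻¹` on `(c c^*) ^ i`, and `0` on all other basis monomials. -/
def haarMon (q : Set.Ioo (0 : ℝ) 1) (p : ℤ × ℕ × ℕ) : ℂ :=
  if p.1 = 0 ∧ p.2.1 = p.2.2 then (∑ l ∈ Finset.range (p.2.1 + 1), qc q ^ (2 * l))⁻¹ else 0

/-- The Haar state. -/
def haar (q : Set.Ioo (0 : ℝ) 1) : SUq q →ₗ[ℂ] ℂ :=
  Finsupp.linearCombination ℂ (haarMon q) ∘ₗ expand q

theorem expand_a_c_cs (q : Set.Ioo (0 : ℝ) 1) (k i j : ℕ) :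
    expand q (gen q .a ^ k * gen q .c ^ i * gen q .cs ^ j) = Finsupp.single ((k : ℤ), i, j) 1 := by
  have hcs : (monMul q .cs ^ j) (Finsupp.single (0, 0, 0) 1) = Finsupp.single (0, 0, j) 1 := by
    induction j with
    | zero => simp
    | succ n ih => rw [pow_succ', Module.End.mul_apply, ih]; simp [monMul]
  have hc : (monMul q .c ^ i) (Finsupp.single (0, 0, j) 1) = Finsupp.single (0, i, j) 1 := by
    induction i with
    | zero => simp
    | succ n ih => rw [pow_succ', Module.End.mul_apply, ih]; simp [monMul]
  have ha : (monMul q .a ^ k) (Finsupp.single (0, i, j) 1) = Finsupp.single ((k : ℤ), i, j) 1 := by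
    induction k with
    | zero => simp
    | succ n ih => rw [pow_succ', Module.End.mul_apply, ih]; simp [monMul]
  simp [expand, lift_gen, hcs, hc, ha]

theorem expand_as_c_cs (q : Set.Ioo (0 : ℝ) 1) (k i j : ℕ) :
    expand q (gen q .as ^ k * gen q .c ^ i * gen q .cs ^ j)
      = Finsupp.single (-(k : ℤ), i, j) 1 := by
  have h := expand_a_c_cs q 0 i j
  simp only [expand, pow_zero, one_mul, LinearMap.comp_apply, AlgHom.toLinearMap_apply,
    LinearMap.applyₗ_apply_apply, Nat.cast_zero] at h
  have ha : (monMul q .as ^ k) (Finsupp.single (0, i, j) 1)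
      = Finsupp.single (-(k : ℤ), i, j) 1 := by
    induction k with
    | zero => simp
    | succ n ih =>
      rw [pow_succ', Module.End.mul_apply, ih]
      simp [monMul, sub_eq_add_neg, add_comm]
  rw [mul_assoc]
  simp only [expand, LinearMap.comp_apply, AlgHom.toLinearMap_apply,
    LinearMap.applyₗ_apply_apply]
  rw [map_mul, Module.End.mul_apply, h, map_pow, lift_gen, ha]

theorem haar_a_c_cs (q : Set.Ioo (0 : ℝ) 1) (k i j : ℕ) :
    haar q (gen q .a ^ k * gen q .c ^ i * gen q .cs ^ j) = haarMon q (k, i, j) := by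
  simp [haar, expand_a_c_cs]

theorem haar_as_c_cs (q : Set.Ioo (0 : ℝ) 1) (k i j : ℕ) :
    haar q (gen q .as ^ k * gen q .c ^ i * gen q .cs ^ j) = haarMon q (-k, i, j) := by
  simp [haar, expand_as_c_cs]

theorem haar_one (q : Set.Ioo (0 : ℝ) 1) : haar q 1 = 1 := by
  have h := haar_a_c_cs q 0 0 0
  simpa [haarMon] using h

/-! ## The left action of `U_q(su(2))` -/

/-- The automorphism with `a ↦ t⁻¹ a`, `c ↦ t⁻¹ c`, `a^* ↦ t a^*`, `c^* ↦ t c^*` on generators. -/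
def scaleGen (q : Set.Ioo (0 : ℝ) 1) (t : ℂ) : Gen → SUq q
  | .a => t⁻¹ • gen q .a
  | .as => t • gen q .as
  | .c => t⁻¹ • gen q .c
  | .cs => t • gen q .cs

theorem scaleGen_respects (q : Set.Ioo (0 : ℝ) 1) (t : ℂ) (ht : t ≠ 0) :
    Respects q (scaleGen q t) := by
  have h := gen_respects q
  constructor
  · simp only [scaleGen, smul_mul_smul_comm, h.a_c, smul_smul, mul_comm]
  · simp only [scaleGen, smul_mul_smul_comm, h.a_cs, smul_smul, mul_comm]
  · simp only [scaleGen, smul_mul_smul_comm, h.cs_as, smul_smul, mul_comm]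
  · simp only [scaleGen, smul_mul_smul_comm, h.c_as, smul_smul, mul_comm]
  · simp only [scaleGen, smul_mul_smul_comm, h.c_cs, mul_comm]
  · simp only [scaleGen, smul_mul_smul_comm, mul_inv_cancel₀ ht, one_smul, h.as_a]
  · simp only [scaleGen, smul_mul_smul_comm, inv_mul_cancel₀ ht, one_smul, h.a_as]

/-- `K ▷ x`, on generators `K ▷ a = q^(-1/2) a`, `K ▷ a^* = q^(1/2) a^*`, `K ▷ c = q^(-1/2) c`,
`K ▷ c^* = q^(1/2) c^*`; since `Δ K = K ⊗ K`, it is multiplicative. -/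
def actK (q : Set.Ioo (0 : ℝ) 1) : SUq q →ₐ[ℂ] SUq q :=
  lift q (scaleGen q (qh q)) (scaleGen_respects q _ (qh_ne_zero q))

/-- `K⁻¹ ▷ x`. -/
def actKi (q : Set.Ioo (0 : ℝ) 1) : SUq q →ₐ[ℂ] SUq q :=
  lift q (scaleGen q (qh q)⁻¹) (scaleGen_respects q _ (inv_ne_zero (qh_ne_zero q)))

/-- The values `E ▷ a = - q c^*`, `E ▷ a^* = 0`, `E ▷ c = a^*`, `E ▷ c^* = 0`. -/
def genE (q : Set.Ioo (0 : ℝ) 1) : Gen → SUq q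
  | .a => -(qc q • gen q .cs)
  | .as => 0
  | .c => gen q .as
  | .cs => 0

/-- The values `F ▷ a = 0`, `F ▷ a^* = c`, `F ▷ c = 0`, `F ▷ c^* = - q⁻¹ a`. -/
def genF (q : Set.Ioo (0 : ℝ) 1) : Gen → SUq q
  | .a => 0
  | .as => gen q .c
  | .c => 0
  | .cs => -((qc q)⁻¹ • gen q .a)

/-- The upper triangular matrix with diagonal `K⁻¹ ▷ g`, `K ▷ g` and corner `D g`. -/
def twistGen (q : Set.Ioo (0 : ℝ) 1) (D : Gen → SUq q) (g : Gen) :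
    Matrix (Fin 2) (Fin 2) (SUq q) :=
  !![scaleGen q (qh q)⁻¹ g, D g; 0, scaleGen q (qh q) g]

theorem twistE_respects (q : Set.Ioo (0 : ℝ) 1) : Respects q (twistGen q (genE q)) := by
  have h := gen_respects q
  have h0 := qh_ne_zero q
  have ha : gen q .a * gen q .as = 1 - (qh q * qh q) ^ 2 • (gen q .cs * gen q .c) := by
    rw [eq_sub_iff_add_eq, ← h.a_as, h.c_cs, qh_sq]
  have hb : gen q .as * gen q .a = 1 - gen q .cs * gen q .c := by
    rw [eq_sub_iff_add_eq, h.as_a]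
  constructor
  all_goals
    apply Matrix.ext
    intro x y
    fin_cases x <;> fin_cases y
  all_goals simp [twistGen, Matrix.mul_apply, Fin.sum_univ_two]
  all_goals simp [scaleGen, genE]
  all_goals simp only [h.a_c, h.a_cs, h.cs_as, h.c_as, h.c_cs, ha, hb, ← qh_sq]
  all_goals match_scalars <;> field_simp
  all_goals ring

theorem twistF_respects (q : Set.Ioo (0 : ℝ) 1) : Respects q (twistGen q (genF q)) := by
  have h := gen_respects q
  have h0 := qh_ne_zero q
  have ha : gen q .a * gen q .as = 1 - (qh q * qh q) ^ 2 • (gen q .cs * gen q .c) := by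
    rw [eq_sub_iff_add_eq, ← h.a_as, h.c_cs, qh_sq]
  have hb : gen q .as * gen q .a = 1 - gen q .cs * gen q .c := by
    rw [eq_sub_iff_add_eq, h.as_a]
  constructor
  all_goals
    apply Matrix.ext
    intro x y
    fin_cases x <;> fin_cases y
  all_goals simp [twistGen, Matrix.mul_apply, Fin.sum_univ_two]
  all_goals simp [scaleGen, genF]
  all_goals simp only [h.a_c, h.a_cs, h.cs_as, h.c_as, h.c_cs, ha, hb, ← qh_sq]
  all_goals match_scalars <;> field_simp
  all_goals ring


/-- `E ▷ x`.  Since `Δ E = E ⊗ K + K⁻¹ ⊗ E`, one has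
`E ▷ (x y) = (E ▷ x) (K ▷ y) + (K⁻¹ ▷ x) (E ▷ y)`, that is, `E ▷ x` is the corner of a
multiplicative upper triangular matrix with diagonal `K⁻¹ ▷ x`, `K ▷ x`. -/
def actE (q : Set.Ioo (0 : ℝ) 1) : SUq q →ₗ[ℂ] SUq q :=
  Matrix.entryLinearMap ℂ (SUq q) 0 1 ∘ₗ
    (lift q (twistGen q (genE q)) (twistE_respects q)).toLinearMap

/-- `F ▷ x`; here `Δ F = F ⊗ K + K⁻¹ ⊗ F`. -/
def actF (q : Set.Ioo (0 : ℝ) 1) : SUq q →ₗ[ℂ] SUq q :=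
  Matrix.entryLinearMap ℂ (SUq q) 0 1 ∘ₗ
    (lift q (twistGen q (genF q)) (twistF_respects q)).toLinearMap

theorem actK_gen (q : Set.Ioo (0 : ℝ) 1) (g : Gen) : actK q (gen q g) = scaleGen q (qh q) g :=
  lift_gen q _ _ g

theorem actKi_gen (q : Set.Ioo (0 : ℝ) 1) (g : Gen) :
    actKi q (gen q g) = scaleGen q (qh q)⁻¹ g :=
  lift_gen q _ _ g

theorem actE_gen (q : Set.Ioo (0 : ℝ) 1) (g : Gen) : actE q (gen q g) = genE q g := by
  simp [actE, lift_gen, twistGen]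

theorem actF_gen (q : Set.Ioo (0 : ℝ) 1) (g : Gen) : actF q (gen q g) = genF q g := by
  simp [actF, lift_gen, twistGen]

/-- The coordinate algebra of the standard Podleś sphere: the elements with `K ▷ x = x`, i.e. the
coinvariants of the right coaction of `U(1)`. -/
def sphere (q : Set.Ioo (0 : ℝ) 1) : Subalgebra ℂ (SUq q) :=
  AlgHom.equalizer (actK q) (AlgHom.id ℂ (SUq q))

/-! ## The `4D_+` calculus and its exterior algebra -/

/-- The labels `-, z, +, 0` of the basis of left invariant one-forms. -/
inductive Form
  | minus | z | plus | zero
  deriving DecidableEq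

open Form

instance : Fintype Form := ⟨{minus, z, plus, zero}, by intro x; cases x <;> simp⟩

/-- The left action of the basis elements of the quantum tangent space,
`L_- = q^(1/2) F K⁻¹`, `L_z = (K⁻² - 1) / (q - q⁻¹)`, `L_+ = q^(-1/2) E K⁻¹`,
`L_0 = (q (K² - 1) + q⁻¹ (K⁻² - 1)) / (q - q⁻¹)² + F E`. -/
def tangent (q : Set.Ioo (0 : ℝ) 1) : Form → (SUq q →ₗ[ℂ] SUq q)
  | minus => qh q • (actF q ∘ₗ (actKi q).toLinearMap)
  | z => (qc q - (qc q)⁻¹)⁻¹ • (((actKi q).comp (actKi q)).toLinearMap - LinearMap.id)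
  | plus => (qh q)⁻¹ • (actE q ∘ₗ (actKi q).toLinearMap)
  | zero => ((qc q - (qc q)⁻¹) ^ 2)⁻¹ •
        (qc q • (((actK q).comp (actK q)).toLinearMap - LinearMap.id)
          + (qc q)⁻¹ • (((actKi q).comp (actKi q)).toLinearMap - LinearMap.id))
      + actF q ∘ₗ actE q

/-- The left action of the elements `f_{ab}`, which give the bimodule structure
`ω_a x = ∑_b (f_{ab} ▷ x) ω_b`. -/
def fmat (q : Set.Ioo (0 : ℝ) 1) : Form → Form → (SUq q →ₗ[ℂ] SUq q)
  | minus, minus => LinearMap.id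
  | minus, zero => (qh q)⁻¹ • ((actK q).toLinearMap ∘ₗ actE q)
  | z, minus => ((qc q - (qc q)⁻¹) * qh q) • (actF q ∘ₗ (actKi q).toLinearMap)
  | z, z => ((actKi q).comp (actKi q)).toLinearMap
  | z, plus => ((qc q - (qc q)⁻¹) * (qh q)⁻¹) • (actE q ∘ₗ (actKi q).toLinearMap)
  | z, zero => (qc q - (qc q)⁻¹) • (actF q ∘ₗ actE q
      + ((qc q)⁻¹ * ((qc q - (qc q)⁻¹) ^ 2)⁻¹) •
        (((actKi q).comp (actKi q)).toLinearMap - ((actK q).comp (actK q)).toLinearMap))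
  | plus, plus => LinearMap.id
  | plus, zero => (qh q)⁻¹ • (actF q ∘ₗ (actK q).toLinearMap)
  | zero, zero => ((actK q).comp (actK q)).toLinearMap
  | _, _ => 0

/-- The matrix with entry `1` at `(n, k)`, standing for `ω_n ⊗ ω_k`. -/
def ten (n k : Form) : Matrix Form Form ℂ := Matrix.single n k 1

/-- The braiding on left invariant forms: `σ (ω_a ⊗ ω_b) = ∑_{n,k} (sigma q a b n k) ω_n ⊗ ω_k`. -/
def sigma (q : Set.Ioo (0 : ℝ) 1) : Form → Form → Matrix Form Form ℂ
  | minus, minus => ten minus minus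
  | plus, plus => ten plus plus
  | zero, zero => ten zero zero
  | z, z => ten z z + (qc q ^ 2 - (qc q ^ 2)⁻¹) • (ten z zero + ten minus plus - ten plus minus)
  | minus, plus => ten plus minus - ten z zero
  | plus, minus => ten minus plus + ten z zero
  | minus, z => ten z minus + (1 + qc q ^ 2) • ten minus zero
  | z, minus => (1 - (qc q ^ 2)⁻¹) • ten z minus + (qc q ^ 2)⁻¹ • ten minus z
      - (1 + (qc q ^ 2)⁻¹) • ten minus zero
  | minus, zero => ten zero minus + (1 - qc q ^ 2) • ten minus zero
  | zero, minus => qc q ^ 2 • ten minus zero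
  | z, plus => qc q ^ 2 • ten plus z + (1 - qc q ^ 2) • ten z plus
      + (1 + qc q ^ 2) • ten plus zero
  | plus, z => ten z plus - (1 + (qc q ^ 2)⁻¹) • ten plus zero
  | z, zero => ten zero z + (qc q - (qc q)⁻¹) ^ 2 • (ten plus minus - ten minus plus)
      - (qc q - (qc q)⁻¹) ^ 2 • ten z zero
  | zero, z => ten z zero
  | plus, zero => ten zero plus + (1 - (qc q ^ 2)⁻¹) • ten plus zero
  | zero, plus => (qc q ^ 2)⁻¹ • ten plus zero

/-- The braiding `σ_i` in the places `i`, `i + 1` of the `k`-fold tensor power of the space of left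
invariant one-forms.  A tensor `∑_w c w • ω_{w 0} ⊗ ⋯ ⊗ ω_{w (k-1)}` is given by its family of
coefficients `c`.  (The value for `k ≤ i + 1` is never used.) -/
def braidAt (q : Set.Ioo (0 : ℝ) 1) (k i : ℕ) : Module.End ℂ ((Fin k → Form) → ℂ) :=
  if h : i + 1 < k then
    LinearMap.pi fun w => ∑ a : Form, ∑ b : Form,
      sigma q a b (w ⟨i, by omega⟩) (w ⟨i + 1, h⟩) •
        LinearMap.proj (Function.update (Function.update w ⟨i, by omega⟩ a) ⟨i + 1, h⟩ b)
  else 0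

/-- `1 - σ_{m-1} + σ_{m-2} σ_{m-1} - ⋯ + (-1)^m σ_0 ⋯ σ_{m-1}`, the alternating sum over the minimal
coset representatives of the symmetric group on `m + 1` letters modulo the one on `m` letters. -/
def cosetSum (q : Set.Ioo (0 : ℝ) 1) (k : ℕ) : ℕ → Module.End ℂ ((Fin k → Form) → ℂ)
  | 0 => 1
  | m + 1 => 1 - cosetSum q k m * braidAt q k m

/-- The alternating sum, over the permutations `π` of the first `m + 1` places, of the operators
`σ_π` obtained from reduced words of `π`. -/
def antisymAux (q : Set.Ioo (0 : ℝ) 1) (k : ℕ) : ℕ → Module.End ℂ ((Fin k → Form) → ℂ)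
  | 0 => 1
  | m + 1 => cosetSum q k (m + 1) * antisymAux q k m

/-- The antisymmetriser `∑_π sgn(π) σ_π` on the `k`-fold tensor power of the space of left invariant
one-forms. -/
def antisym (q : Set.Ioo (0 : ℝ) 1) (k : ℕ) : Module.End ℂ ((Fin k → Form) → ℂ) :=
  antisymAux q k (k - 1)

/-- The relations of the exterior algebra on generators `x ∈ SUq q` and `ω_a`: the products and
linear combinations of elements of `SUq q` are the given ones, the bimodule relations
`ω_a x = ∑_b (f_{ab} ▷ x) ω_b` hold (this gives the tensor algebra over `SUq q` of the bimodule of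
one-forms, free as a left module on the words in the `ω_a`), and the kernels of all antisymmetrisers
vanish. -/
inductive OmegaRel (q : Set.Ioo (0 : ℝ) 1) :
    FreeAlgebra ℂ (SUq q ⊕ Form) → FreeAlgebra ℂ (SUq q ⊕ Form) → Prop
  | scalar (t : ℂ) : OmegaRel q (FreeAlgebra.ι ℂ (Sum.inl (algebraMap ℂ (SUq q) t)))
      (algebraMap ℂ _ t)
  | add (x y : SUq q) : OmegaRel q (FreeAlgebra.ι ℂ (Sum.inl (x + y)))
      (FreeAlgebra.ι ℂ (Sum.inl x) + FreeAlgebra.ι ℂ (Sum.inl y))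
  | mul (x y : SUq q) : OmegaRel q (FreeAlgebra.ι ℂ (Sum.inl (x * y)))
      (FreeAlgebra.ι ℂ (Sum.inl x) * FreeAlgebra.ι ℂ (Sum.inl y))
  | bimodule (a : Form) (x : SUq q) :
      OmegaRel q (FreeAlgebra.ι ℂ (Sum.inr a) * FreeAlgebra.ι ℂ (Sum.inl x))
        (∑ b : Form, FreeAlgebra.ι ℂ (Sum.inl (fmat q a b x)) * FreeAlgebra.ι ℂ (Sum.inr b))
  | wedge (k : ℕ) (c : (Fin k → Form) → ℂ) (hc : antisym q k c = 0) :
      OmegaRel q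
        (∑ w : Fin k → Form, c w • (List.ofFn fun i => FreeAlgebra.ι ℂ (Sum.inr (w i))).prod) 0

/-- The exterior algebra of the `4D_+` bicovariant calculus on `SU_q(2)`.  Its product is the wedge
product. -/
def OmegaSU (q : Set.Ioo (0 : ℝ) 1) : Type := RingQuot (OmegaRel q)

instance (q : Set.Ioo (0 : ℝ) 1) : Ring (OmegaSU q) :=
  inferInstanceAs (Ring (RingQuot (OmegaRel q)))

instance (q : Set.Ioo (0 : ℝ) 1) : Algebra ℂ (OmegaSU q) :=
  inferInstanceAs (Algebra ℂ (RingQuot (OmegaRel q)))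

/-- The canonical projection onto the exterior algebra. -/
def mkOmega (q : Set.Ioo (0 : ℝ) 1) : FreeAlgebra ℂ (SUq q ⊕ Form) →ₐ[ℂ] OmegaSU q :=
  RingQuot.mkAlgHom ℂ (OmegaRel q)

theorem mkOmega_rel (q : Set.Ioo (0 : ℝ) 1) {x y : FreeAlgebra ℂ (SUq q ⊕ Form)}
    (h : OmegaRel q x y) : mkOmega q x = mkOmega q y :=
  RingQuot.mkAlgHom_rel ℂ h

/-- The map from `SUq q` to the forms of degree zero. -/
def inc (q : Set.Ioo (0 : ℝ) 1) : SUq q →ₐ[ℂ] OmegaSU q where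
  toFun x := mkOmega q (FreeAlgebra.ι ℂ (Sum.inl x))
  map_one' := by
    have h := mkOmega_rel q (OmegaRel.scalar (q := q) 1)
    simpa using h
  map_mul' x y := by
    simpa using mkOmega_rel q (OmegaRel.mul x y)
  map_zero' := by
    have h := mkOmega_rel q (OmegaRel.scalar (q := q) 0)
    simpa using h
  map_add' x y := by
    simpa using mkOmega_rel q (OmegaRel.add x y)
  commutes' t := by
    simpa using mkOmega_rel q (OmegaRel.scalar (q := q) t)

/-- The left invariant one-forms `ω_a`. -/
def omega (q : Set.Ioo (0 : ℝ) 1) (a : Form) : OmegaSU q :=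
  mkOmega q (FreeAlgebra.ι ℂ (Sum.inr a))

/-- The differential on functions, `d x = ∑_a (L_a ▷ x) ω_a`. -/
def diff (q : Set.Ioo (0 : ℝ) 1) : SUq q →ₗ[ℂ] OmegaSU q :=
  ∑ a : Form, LinearMap.mulRight ℂ (omega q a) ∘ₗ (inc q).toLinearMap ∘ₗ tangent q a

/-- The space of `k`-forms on `SU_q(2)`, spanned by the `x ω_{a_1} ∧ ⋯ ∧ ω_{a_k}`. -/
def formsSU (q : Set.Ioo (0 : ℝ) 1) (k : ℕ) : Submodule ℂ (OmegaSU q) :=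
  Subalgebra.toSubmodule (inc q).range * Submodule.span ℂ (Set.range (omega q)) ^ k

/-! ## The exterior algebra of the sphere and the integral -/

/-- The exterior algebra of the sphere, the restriction of the exterior algebra of `SU_q(2)`: the
subalgebra generated by the functions on the sphere and their differentials. -/
def OmegaS (q : Set.Ioo (0 : ℝ) 1) : Subalgebra ℂ (OmegaSU q) :=
  Algebra.adjoin ℂ (inc q '' (sphere q : Set (SUq q)) ∪ diff q '' (sphere q : Set (SUq q)))

/-- The space of `k`-forms on the sphere. -/
def formsS (q : Set.Ioo (0 : ℝ) 1) (k : ℕ) : Submodule ℂ (OmegaS q) :=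
  (formsSU q k).comap (OmegaS q).val.toLinearMap

/-- The form `m ω_- ∧ ω_+ ∧ ω_0`. -/
def volumeForm (q : Set.Ioo (0 : ℝ) 1) (m : ℝ) : OmegaSU q :=
  (m : ℂ) • (omega q minus * omega q plus * omega q zero)

/-- `I` is the integral for the volume form `m ω_- ∧ ω_+ ∧ ω_0`. -/
structure IsIntegral (q : Set.Ioo (0 : ℝ) 1) (m : ℝ) (I : OmegaS q →ₗ[ℂ] ℂ) : Prop where
  lower : ∀ k < 3, ∀ θ ∈ formsS q k, I θ = 0
  top : ∀ f ∈ sphere q, ∀ θ : OmegaS q, (θ : OmegaSU q) = inc q f * volumeForm q m →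
    I θ = haar q f

/-- Left faithfulness of a functional on the exterior algebra of the sphere, whose top degree
is `3`. -/
def LeftFaithful (q : Set.Ioo (0 : ℝ) 1) (I : OmegaS q →ₗ[ℂ] ℂ) : Prop :=
  ∀ k ≤ 3, ∀ η ∈ formsS q k, (∀ η' ∈ formsS q (3 - k), I (η' * η) = 0) → η = 0

end QSphere

end

/-! ### The action of `U_q(su(2))` on `SUq q` and its commutation relations. -/

noncomputable section

namespace QSphere

variable {q : Set.Ioo (0 : ℝ) 1}

/-! Grade `SUq q` by weight: `x` has weight `n` when `K ▷ x = q^n x`, so the sphere is the part of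
weight `0`. For `f` on the sphere the `K`-terms of the tangent vectors vanish, hence `df = q^{1/2}(F
▷ f) ω_- + q^{-1/2}(E ▷ f) ω_+ + (FE ▷ f) ω_0`, with coefficients of weights `-1`, `1`, `0` and no
`ω_z`. The forms `ω_-`, `ω_+`, `ω_0` anticommute, have square zero, and move past functions without
producing `ω_z`. Therefore `Ω(S²_q)` lies in the space `sphereForms` of combinations of the eight
ordered monomials in `ω_-`, `ω_+`, `ω_0`, each coefficient having the weight that makes the term
invariant (`OmegaS_le_sphereForms`).

Conversely, the coefficients of `d(cc^*)`, `d(ac^*)`, `d(ca^*)` form a 3×3 matrix over `SUq q` with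
a left inverse, so each `x ω_-`, `x ω_+`, `x ω_0` of the right weight is a combination of
differentials. Products of these give everything (`sphereForms_le_OmegaS`). In degree three this
says `Ω³(S²_q) = A(S²_q) μ`, and a grading homomorphism separates the degrees.

For the integral to exist, the coefficient of the volume form must be well defined in an algebra
given by generators and relations. To this end the exterior algebra is represented by matrices of
operators on `SUq q`, indexed by the basis of a graded space of dimension 1+4+4+1 on which the left
invariant forms act (`rep`). The entry from bottom to top degree, applied to `1`, reads off the
coefficient (`topPart`, `topPart_volume`). Products of more than three one-forms act by zero, so
only the antisymmetrisers of degree at most three matter, and these are controlled by ten quadratic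
relations (`wedge_of_quadratic`).

Left faithfulness: multiplying a `k`-form by `x` times a complementary monomial isolates one
coefficient `y`, and the pairing becomes `h(x y)` or `h(x (K² ▷ y))` up to sign. It remains that `h`
pairs weight `-n` with weight `n` nondegenerately (`haar_nondegenerate_weight`). This reduces to
polynomials in `cc^*`, where the moments `(1 - q²)/(1 - q^{2(i+1)})` give a Cauchy-type kernel
(`moment_nondegenerate`). -/

theorem SUq.induction {P : SUq q → Prop} (halg : ∀ t : ℂ, P (algebraMap ℂ _ t))
    (hgen : ∀ g, P (gen q g)) (hadd : ∀ x y, P x → P y → P (x + y))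
    (hmul : ∀ x y, P x → P y → P (x * y)) (x : SUq q) : P x := by
  obtain ⟨u, rfl⟩ := RingQuot.mkAlgHom_surjective ℂ (SURel q) x
  change P (mk q u)
  induction u using FreeAlgebra.induction with
  | grade0 r => rw [AlgHom.commutes]; exact halg r
  | grade1 g => exact hgen g
  | mul a b ha hb => rw [map_mul]; exact hmul _ _ ha hb
  | add a b ha hb => rw [map_add]; exact hadd _ _ ha hb

theorem algHom_ext_gen {B : Type} [Ring B] [Algebra ℂ B] {φ ψ : SUq q →ₐ[ℂ] B}
    (h : ∀ g, φ (gen q g) = ψ (gen q g)) : φ = ψ := by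
  ext x
  induction x using SUq.induction with
  | halg t => simp
  | hgen g => exact h g
  | hadd x y hx hy => simp [hx, hy]
  | hmul x y hx hy => simp [hx, hy]

@[simp] theorem actK_actKi (x : SUq q) : actK q (actKi q x) = x := by
  have : (actK q).comp (actKi q) = AlgHom.id ℂ _ := by
    apply algHom_ext_gen
    intro g
    have h0 := qh_ne_zero q
    cases g <;> simp [actKi_gen, actK_gen, scaleGen, smul_smul, h0]
  exact DFunLike.congr_fun this x

@[simp] theorem actKi_actK (x : SUq q) : actKi q (actK q x) = x := by
  have : (actKi q).comp (actK q) = AlgHom.id ℂ _ := by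
    apply algHom_ext_gen
    intro g
    have h0 := qh_ne_zero q
    cases g <;> simp [actKi_gen, actK_gen, scaleGen, smul_smul, h0]
  exact DFunLike.congr_fun this x

/-- Upper triangularity and the diagonal entries `K⁻¹`, `K` propagate from generators to products.
The corner of a product of two such matrices is then the twisted Leibniz rule for `E` and `F`. -/
theorem twist_apply (D : Gen → SUq q) (h : Respects q (twistGen q D)) (x : SUq q) :
    lift q (twistGen q D) h x = !![actKi q x, lift q (twistGen q D) h x 0 1; 0, actK q x] := by
  induction x using SUq.induction with
  | halg t =>
    ext i j
    fin_cases i <;> fin_cases j <;> simp [Matrix.algebraMap_matrix_apply]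
  | hgen g =>
    ext i j
    fin_cases i <;> fin_cases j <;> simp [lift_gen, twistGen, actKi_gen, actK_gen]
  | hadd x y hx hy =>
    rw [map_add, hx, hy]
    ext i j
    fin_cases i <;> fin_cases j <;> simp
  | hmul x y hx hy =>
    rw [map_mul, hx, hy]
    ext i j
    fin_cases i <;> fin_cases j <;> simp [Matrix.mul_apply, Fin.sum_univ_two]

theorem actE_mul (x y : SUq q) :
    actE q (x * y) = actE q x * actK q y + actKi q x * actE q y := by
  have hx := twist_apply _ (twistE_respects q) x
  have hy := twist_apply _ (twistE_respects q) y
  simp only [actE, LinearMap.comp_apply, AlgHom.toLinearMap_apply, Matrix.entryLinearMap_apply,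
    map_mul, Matrix.mul_apply, Fin.sum_univ_two]
  rw [hx, hy]
  simp [add_comm]

theorem actF_mul (x y : SUq q) :
    actF q (x * y) = actF q x * actK q y + actKi q x * actF q y := by
  have hx := twist_apply _ (twistF_respects q) x
  have hy := twist_apply _ (twistF_respects q) y
  simp only [actF, LinearMap.comp_apply, AlgHom.toLinearMap_apply, Matrix.entryLinearMap_apply,
    map_mul, Matrix.mul_apply, Fin.sum_univ_two]
  rw [hx, hy]
  simp [add_comm]

@[simp] theorem actE_algebraMap (t : ℂ) : actE q (algebraMap ℂ _ t) = 0 := by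
  simp [actE, Matrix.algebraMap_matrix_apply]

@[simp] theorem actF_algebraMap (t : ℂ) : actF q (algebraMap ℂ _ t) = 0 := by
  simp [actF, Matrix.algebraMap_matrix_apply]

theorem qc_lt_one_ne (q : Set.Ioo (0 : ℝ) 1) {n : ℕ} (hn : n ≠ 0) : qc q ^ n ≠ 1 := by
  have h : (q : ℝ) ^ n < 1 := pow_lt_one₀ q.2.1.le q.2.2 hn
  intro h1
  have : (((q : ℝ) ^ n : ℝ) : ℂ) = ((1 : ℝ) : ℂ) := by push_cast; exact h1
  exact h.ne (Complex.ofReal_injective this)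

theorem actK_actE (x : SUq q) : actK q (actE q x) = qc q • actE q (actK q x) := by
  have h0 := qh_ne_zero q
  induction x using SUq.induction with
  | halg t => simp
  | hgen g =>
    cases g <;> simp [actK_gen, actE_gen, genE, scaleGen, ← qh_sq, smul_smul]
    all_goals match_scalars; field_simp
  | hadd x y hx hy => simp [hx, hy]
  | hmul x y hx hy => simp [actE_mul, hx, hy]

theorem actK_actF (x : SUq q) : actK q (actF q x) = (qc q)⁻¹ • actF q (actK q x) := by
  have h0 := qh_ne_zero q
  induction x using SUq.induction with
  | halg t => simp
  | hgen g =>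
    cases g <;> simp [actK_gen, actF_gen, genF, scaleGen, ← qh_sq, smul_smul]
    all_goals match_scalars; field_simp
  | hadd x y hx hy => simp [hx, hy]
  | hmul x y hx hy => simp [actF_mul, hx, hy]

theorem actKi_actE (x : SUq q) : actKi q (actE q x) = (qc q)⁻¹ • actE q (actKi q x) := by
  have h := congrArg (actKi q) (actK_actE (actKi q x))
  simp only [actKi_actK, actK_actKi, map_smul] at h
  rw [h, smul_smul, inv_mul_cancel₀ (qc_ne_zero q), one_smul]

theorem actKi_actF (x : SUq q) : actKi q (actF q x) = qc q • actF q (actKi q x) := by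
  have h := congrArg (actKi q) (actK_actF (actKi q x))
  simp only [actKi_actK, actK_actKi, map_smul] at h
  rw [h, smul_smul, mul_inv_cancel₀ (qc_ne_zero q), one_smul]

theorem actE_actF (x : SUq q) : actE q (actF q x) = actF q (actE q x)
    + (qc q - (qc q)⁻¹)⁻¹ • (actK q (actK q x) - actKi q (actKi q x)) := by
  have h0 := qh_ne_zero q
  -- Up to a power of `qh q`, this is the denominator `q - q⁻¹`.
  have hs : qh q ^ 4 - 1 ≠ 0 := by
    rw [sub_ne_zero, show qh q ^ 4 = qc q ^ 2 by rw [← qh_sq]; ring]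
    exact qc_lt_one_ne q two_ne_zero
  induction x using SUq.induction with
  | halg t => simp
  | hgen g =>
    cases g <;> simp [actK_gen, actKi_gen, actE_gen, actF_gen, genE, genF, scaleGen, smul_smul,
      ← sub_smul]
    all_goals
      match_scalars
      rw [← qh_sq]
      field_simp
      try ring
  | hadd x y hx hy => simp only [map_add, hx, hy]; module
  | hmul x y hx hy =>
    simp only [actE_mul, actF_mul, map_add, map_mul, hx, hy, actKi_actF, actKi_actE, actK_actE,
      actK_actF, smul_mul_assoc, mul_smul_comm, add_mul, mul_add, sub_mul, mul_sub]
    module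

end QSphere

end

noncomputable section

namespace QSphere

variable {q : Set.Ioo (0 : ℝ) 1}

/-! ## The monomial basis -/

theorem mul_pow_of_smul_comm {A : Type*} [Ring A] [Algebra ℂ A] {x y : A} {r : ℂ}
    (h : x * y = r • (y * x)) (n : ℕ) : x * y ^ n = r ^ n • (y ^ n * x) := by
  induction n with
  | zero => simp
  | succ n ih =>
    rw [pow_succ, ← mul_assoc, ih, smul_mul_assoc, mul_assoc, h, mul_smul_comm, smul_smul,
      pow_succ, mul_assoc]

/-- The monomial with index `p`. -/
def monomialEl (q : Set.Ioo (0 : ℝ) 1) (p : ℤ × ℕ × ℕ) : SUq q :=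
  (if 0 ≤ p.1 then gen q .a ^ p.1.toNat else gen q .as ^ (-p.1).toNat) *
    (gen q .c ^ p.2.1 * gen q .cs ^ p.2.2)

/-- The linear combination of monomials with given coefficients. -/
def assemble (q : Set.Ioo (0 : ℝ) 1) : ((ℤ × ℕ × ℕ) →₀ ℂ) →ₗ[ℂ] SUq q :=
  Finsupp.linearCombination ℂ (monomialEl q)

theorem monomialEl_nat (k i j : ℕ) : monomialEl q (k, i, j) =
    gen q .a ^ k * (gen q .c ^ i * gen q .cs ^ j) := by
  simp [monomialEl]

theorem monomialEl_neg (k i j : ℕ) : monomialEl q (-(k : ℤ), i, j) =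
    gen q .as ^ k * (gen q .c ^ i * gen q .cs ^ j) := by
  rcases Nat.eq_zero_or_pos k with rfl | hk
  · simp [monomialEl]
  · simp [monomialEl, hk.ne']

theorem c_mul_a_pow (n : ℕ) :
    gen q .c * gen q .a ^ n = (qc q)⁻¹ ^ n • (gen q .a ^ n * gen q .c) := by
  apply mul_pow_of_smul_comm
  rw [(gen_respects q).a_c, smul_smul, inv_mul_cancel₀ (qc_ne_zero q), one_smul]

theorem cs_mul_a_pow (n : ℕ) :
    gen q .cs * gen q .a ^ n = (qc q)⁻¹ ^ n • (gen q .a ^ n * gen q .cs) := by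
  apply mul_pow_of_smul_comm
  rw [(gen_respects q).a_cs, smul_smul, inv_mul_cancel₀ (qc_ne_zero q), one_smul]

theorem c_mul_as_pow (n : ℕ) :
    gen q .c * gen q .as ^ n = qc q ^ n • (gen q .as ^ n * gen q .c) :=
  mul_pow_of_smul_comm (gen_respects q).c_as n

theorem cs_mul_as_pow (n : ℕ) :
    gen q .cs * gen q .as ^ n = qc q ^ n • (gen q .as ^ n * gen q .cs) :=
  mul_pow_of_smul_comm (gen_respects q).cs_as n

theorem cs_mul_c_pow (i : ℕ) (x : SUq q) :
    gen q .cs * (gen q .c ^ i * x) = gen q .c ^ i * (gen q .cs * x) := by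
  have h : Commute (gen q .cs) (gen q .c) := (gen_respects q).c_cs.symm
  rw [← mul_assoc, (h.pow_right i).eq, mul_assoc]

/-- Reordering by the commutation relations shows that `monMul` really describes left
multiplication. Two terms arise only when `a^*` meets a power of `a`, or `a` a power of `a^*`. -/
theorem gen_mul_monomialEl (g : Gen) (p : ℤ × ℕ × ℕ) :
    gen q g * monomialEl q p = assemble q (monMul q g (Finsupp.single p 1)) := by
  obtain ⟨k, i, j⟩ := p
  have h0 := qc_ne_zero q
  have hr := gen_respects q
  obtain ⟨n, rfl | rfl⟩ := k.eq_nat_or_neg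
  · cases g
    · have : (0 : ℤ) ≤ n := by positivity
      simp only [monMul, Finsupp.linearCombination_single, assemble, one_smul, this, if_true]
      rw [← Nat.cast_succ, monomialEl_nat, monomialEl_nat, pow_succ']
      simp only [mul_assoc]
    · rcases n with _ | n
      · simp [monMul, assemble]
        rw [show (-1 : ℤ) = -((1 : ℕ) : ℤ) by simp, monomialEl_neg]
        simp [monomialEl]
      · have h1 : ¬ ((n + 1 : ℕ) : ℤ) ≤ 0 := by push_cast; omega
        have h2 : ((n + 1 : ℕ) : ℤ) - 1 = n := by push_cast; ring
        simp only [monMul, Finsupp.linearCombination_single, assemble, one_smul, h1, if_false,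
          map_sub, h2, monomialEl_nat]
        -- Use `a^* a = 1 - c^* c`; moving `c` and `c^*` past `a^n` costs `q⁻ⁿ` each, which gives
        -- the factor `q^{-2n}`.
        rw [pow_succ', mul_assoc, ← mul_assoc (gen q .as), eq_sub_of_add_eq hr.as_a, sub_mul,
          one_mul, mul_assoc (gen q .cs), ← mul_assoc (gen q .c), c_mul_a_pow, smul_mul_assoc,
          mul_smul_comm, mul_assoc (gen q .a ^ n), ← mul_assoc (gen q .cs), cs_mul_a_pow,
          smul_mul_assoc, smul_smul, mul_assoc, ← mul_assoc (gen q .c), ← pow_succ', cs_mul_c_pow,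
          ← pow_succ', ← mul_pow, ← zpow_natCast, ← mul_inv, ← zpow_neg_one (qc q * qc q), ← zpow_mul,
          mul_zpow, ← zpow_add₀ h0]
        congr 3
        ring
    · simp only [monMul, Finsupp.linearCombination_single, assemble, one_smul, monomialEl_nat]
      rw [← mul_assoc, c_mul_a_pow, smul_mul_assoc, mul_assoc, ← mul_assoc (gen q .c), ← pow_succ',
        inv_pow, zpow_neg, zpow_natCast]
    · simp only [monMul, Finsupp.linearCombination_single, assemble, one_smul, monomialEl_nat]
      rw [← mul_assoc, cs_mul_a_pow, smul_mul_assoc, mul_assoc, cs_mul_c_pow, ← pow_succ',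
        inv_pow, zpow_neg, zpow_natCast]
  · cases g
    · rcases n with _ | n
      · simp [monMul, assemble]
        rw [show (1 : ℤ) = ((1 : ℕ) : ℤ) by simp, monomialEl_nat]
        simp [monomialEl]
      · have h1 : ¬ 0 ≤ -((n + 1 : ℕ) : ℤ) := by push_cast; omega
        have h2 : -((n + 1 : ℕ) : ℤ) + 1 = -(n : ℤ) := by push_cast; ring
        simp only [monMul, Finsupp.linearCombination_single, assemble, one_smul, h1, if_false,
          map_sub, h2, monomialEl_neg]
        -- Use `a a^* = 1 - q² c c^*`; moving `c` and `c^*` past `a^{*n}` costs `q^n` each, which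
        -- gives `q^{2n+2}`.
        rw [pow_succ', mul_assoc, ← mul_assoc (gen q .a), eq_sub_of_add_eq hr.a_as, sub_mul,
          one_mul, hr.c_cs, smul_mul_assoc, mul_assoc (gen q .cs), ← mul_assoc (gen q .c),
          c_mul_as_pow, smul_mul_assoc,
          mul_smul_comm, mul_assoc (gen q .as ^ n), ← mul_assoc (gen q .cs), cs_mul_as_pow,
          smul_mul_assoc, smul_smul, smul_smul, mul_assoc, ← mul_assoc (gen q .c), ← pow_succ',
          mul_assoc (gen q .as ^ n) (gen q .cs), cs_mul_c_pow, ← pow_succ', ← pow_add, ← pow_add, ← zpow_natCast]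
        congr 3
        push_cast
        ring
    · have : -(n : ℤ) ≤ 0 := by simp
      simp only [monMul, Finsupp.linearCombination_single, assemble, one_smul, this, if_true]
      rw [show -(n : ℤ) - 1 = -((n + 1 : ℕ) : ℤ) by push_cast; ring, monomialEl_neg,
        monomialEl_neg, pow_succ']
      simp only [mul_assoc]
    · simp only [monMul, Finsupp.linearCombination_single, assemble, one_smul, monomialEl_neg]
      rw [← mul_assoc, c_mul_as_pow, smul_mul_assoc, mul_assoc, ← mul_assoc (gen q .c), ← pow_succ',
        neg_neg, zpow_natCast]
    · simp only [monMul, Finsupp.linearCombination_single, assemble, one_smul, monomialEl_neg]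
      rw [← mul_assoc, cs_mul_as_pow, smul_mul_assoc, mul_assoc, cs_mul_c_pow, ← pow_succ',
        neg_neg, zpow_natCast]

/-- Left multiplication in terms of the monomial basis. -/
def leftMul (q : Set.Ioo (0 : ℝ) 1) : SUq q →ₐ[ℂ] Module.End ℂ ((ℤ × ℕ × ℕ) →₀ ℂ) :=
  lift q (monMul q) (monMul_respects q)

theorem leftMul_gen (g : Gen) : leftMul q (gen q g) = monMul q g := lift_gen q _ _ g

theorem assemble_leftMul (x : SUq q) (v : (ℤ × ℕ × ℕ) →₀ ℂ) :
    assemble q (leftMul q x v) = x * assemble q v := by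
  induction x using SUq.induction generalizing v with
  | halg t => simp [Module.algebraMap_end_apply, Algebra.smul_def]
  | hgen g =>
    rw [leftMul_gen]
    induction v using Finsupp.induction_linear with
    | zero => simp
    | add v w hv hw => simp [hv, hw, mul_add]
    | single p t =>
      rw [← mul_one t, ← smul_eq_mul, ← Finsupp.smul_single, map_smul, map_smul, map_smul,
        ← gen_mul_monomialEl, mul_smul_comm]
      simp [assemble]
  | hadd x y hx hy => simp [hx, hy, add_mul]
  | hmul x y hx hy => simp [hx, hy, mul_assoc]

/-- Apply `assemble_leftMul` to the monomial `1`. The monomials thus span, and `expand` loses no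
information. -/
theorem assemble_expand (x : SUq q) : assemble q (expand q x) = x := by
  have h := assemble_leftMul x (Finsupp.single (0, 0, 0) 1)
  rw [show assemble q (Finsupp.single (0, 0, 0) 1) = 1 by simp [assemble, monomialEl],
    mul_one] at h
  exact h

theorem expand_injective (q : Set.Ioo (0 : ℝ) 1) : Function.Injective (expand q) :=
  Function.LeftInverse.injective (g := assemble q) assemble_expand

theorem expand_mul (x y : SUq q) : expand q (x * y) = leftMul q x (expand q y) := by
  change leftMul q (x * y) _ = _
  rw [map_mul]
  rfl

/-! ## Nondegeneracy of the Haar state -/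

open Polynomial

/-- The moment functional of the Haar state on polynomials in `c c^*`. -/
def moment (q : Set.Ioo (0 : ℝ) 1) : ℂ[X] →ₗ[ℂ] ℂ :=
  Polynomial.lsum fun i => LinearMap.mulRight ℂ (∑ l ∈ Finset.range (i + 1), qc q ^ (2 * l))⁻¹

theorem moment_X_pow (i : ℕ) :
    moment q (X ^ i) = (∑ l ∈ Finset.range (i + 1), qc q ^ (2 * l))⁻¹ := by
  rw [← monomial_one_right_eq_X_pow]
  simp [moment, Polynomial.lsum_apply]

/-- Summing the geometric series turns the Hankel matrix of the moments into a Cauchy-type kernel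
`1/(1 - q^{2(i+1)} q^{2r})`. -/
theorem moment_X_pow' (i : ℕ) :
    moment q (X ^ i) = (1 - qc q ^ 2) * (1 - qc q ^ (2 * (i + 1)))⁻¹ := by
  rw [moment_X_pow]
  simp only [pow_mul]
  have h1 : qc q ^ 2 - 1 ≠ 0 := sub_ne_zero.2 (qc_lt_one_ne q two_ne_zero)
  rw [geom_sum_eq (qc_lt_one_ne q two_ne_zero), inv_div, ← neg_sub 1 (qc q ^ 2), ← neg_sub 1 ((qc q ^ 2) ^ (i + 1)),
    neg_div_neg_eq, div_eq_mul_inv]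

/-- With `p_i` the coefficients of `P`, the hypothesis says that the rational function `∑ p_i / (1 -
q^{2(i+1)} z)` vanishes at all the points `z = q^{2r}`. These are infinitely many, so its numerator
is zero. The poles are distinct, so every `p_i` vanishes. -/
theorem moment_nondegenerate {P : ℂ[X]} (h : ∀ r, moment q (X ^ r * P) = 0) : P = 0 := by
  have h0 := qc_ne_zero q
  -- The numerator of that rational function over the common denominator.
  set D : ℂ[X] := ∑ i ∈ P.support, C (P.coeff i) *
    ∏ l ∈ P.support.erase i, (1 - C (qc q ^ (2 * (l + 1))) * X) with hD
  have hne : ∀ n : ℕ, 1 - qc q ^ (2 * (n + 1)) ≠ 0 := fun n =>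
    sub_ne_zero.2 (Ne.symm (qc_lt_one_ne q (by omega)))
  have hroot : ∀ r : ℕ, D.eval (qc q ^ (2 * r)) = 0 := by
    intro r
    have h1 := h r
    conv at h1 in P => rw [P.as_sum_support_C_mul_X_pow]
    rw [Finset.mul_sum, map_sum] at h1
    have h2 : ∀ i ∈ P.support, moment q (X ^ r * (C (P.coeff i) * X ^ i))
        = (1 - qc q ^ 2) * (P.coeff i * (1 - qc q ^ (2 * (i + 1)) * qc q ^ (2 * r))⁻¹) := by
      intro i _
      rw [show X ^ r * (C (P.coeff i) * X ^ i) = P.coeff i • X ^ (i + r) by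
        rw [← C_mul', pow_add]; ring, map_smul, moment_X_pow', smul_eq_mul, ← pow_add]
      rw [show 2 * (i + 1) + 2 * r = 2 * (i + r + 1) by ring]
      ring
    rw [Finset.sum_congr rfl h2, ← Finset.mul_sum] at h1
    have h3 := (mul_eq_zero.1 h1).resolve_left
      (sub_ne_zero.2 (Ne.symm (qc_lt_one_ne q two_ne_zero)))
    have h4 : D.eval (qc q ^ (2 * r)) = (∏ l ∈ P.support, (1 - qc q ^ (2 * (l + 1)) * qc q ^ (2 * r)))
        * ∑ i ∈ P.support, P.coeff i * (1 - qc q ^ (2 * (i + 1)) * qc q ^ (2 * r))⁻¹ := by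
      rw [hD, eval_finsetSum, Finset.mul_sum]
      refine Finset.sum_congr rfl fun i hi => ?_
      rw [eval_mul, eval_C, eval_prod, ← Finset.mul_prod_erase _ _ hi]
      have h5 : 1 - qc q ^ (2 * (i + 1)) * qc q ^ (2 * r) ≠ 0 := by
        rw [← pow_add, show 2 * (i + 1) + 2 * r = 2 * (i + r + 1) by ring]
        exact hne _
      have h6 : ∀ c p u : ℂ, u ≠ 0 → c * p = u * p * (c * u⁻¹) := by
        intro c p u hu
        field_simp
      simp only [eval_sub, eval_one, eval_mul, eval_C, eval_X]
      exact h6 _ _ _ h5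
    rw [h4, h3, mul_zero]
  have hinj : Function.Injective fun r : ℕ => qc q ^ (2 * r) := by
    intro r r' hrr
    have h1 : ((q : ℝ) ^ (2 * r) : ℝ) = (q : ℝ) ^ (2 * r') := by
      apply Complex.ofReal_injective
      push_cast
      exact hrr
    have := pow_right_injective₀ q.2.1 q.2.2.ne h1
    omega
  have hD0 : D = 0 := Polynomial.eq_zero_of_infinite_isRoot D
    ((Set.infinite_range_of_injective hinj).mono (by rintro _ ⟨r, rfl⟩; exact hroot r))
  by_contra hP
  obtain ⟨i, hi⟩ := Polynomial.support_nonempty.2 hP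
  -- At the pole belonging to `i`, every other summand of `D` contains a vanishing factor, while the
  -- `i`-th summand does not.
  have h1 : D.eval ((qc q ^ (2 * (i + 1)))⁻¹) = 0 := by rw [hD0, eval_zero]
  rw [hD, eval_finsetSum, Finset.sum_eq_single_of_mem i hi] at h1
  · rw [eval_mul, eval_C, eval_prod] at h1
    rcases mul_eq_zero.1 h1 with h2 | h2
    · exact (Polynomial.mem_support_iff.1 hi) h2
    · obtain ⟨l, hl, h3⟩ := Finset.prod_eq_zero_iff.1 h2
      simp only [eval_sub, eval_one, eval_mul, eval_C, eval_X] at h3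
      rw [← div_eq_mul_inv, sub_eq_zero, eq_div_iff (pow_ne_zero _ h0), one_mul] at h3
      exact (Finset.ne_of_mem_erase hl) (by have := hinj h3; omega)
  · intro j hj hji
    rw [eval_mul, eval_prod]
    have : i ∈ P.support.erase j := Finset.mem_erase.2 ⟨Ne.symm hji, hi⟩
    rw [Finset.prod_eq_zero this, mul_zero]
    simp [h0]

/-- The polynomial `P` in `c c^*`, multiplied by the monomial with index `(k, i, j)`. -/
def polyMon (k : ℤ) (i j : ℕ) : ℂ[X] →ₗ[ℂ] ((ℤ × ℕ × ℕ) →₀ ℂ) :=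
  Polynomial.lsum fun l => Finsupp.lsingle (k, i + l, j + l)

theorem polyMon_monomial (k : ℤ) (i j l : ℕ) (t : ℂ) :
    polyMon k i j (monomial l t) = Finsupp.single (k, i + l, j + l) t := by
  simp [polyMon, Polynomial.lsum_apply]

theorem polyMon_one (k : ℤ) (i j : ℕ) : polyMon k i j 1 = Finsupp.single (k, i, j) 1 := by
  simpa using polyMon_monomial k i j 0 1

theorem monMul_as_polyMon (k : ℤ) (i j : ℕ) (P : ℂ[X]) :
    monMul q .as (polyMon k i j P) = polyMon (k - 1) i j
      (P * if k ≤ 0 then 1 else 1 - C (qc q ^ (-2 * (k - 1))) * X) := by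
  induction P using Polynomial.induction_on' with
  | add P Q hP hQ => simp only [map_add, add_mul, hP, hQ]
  | monomial l t =>
    split_ifs with h
    · rw [mul_one, polyMon_monomial, polyMon_monomial]
      simp [monMul, h]
    · rw [mul_sub, mul_one, ← mul_assoc, monomial_mul_C, monomial_mul_X, map_sub,
        polyMon_monomial, polyMon_monomial, polyMon_monomial]
      simp only [monMul, Finsupp.linearCombination_single, h, if_false, smul_sub,
        Finsupp.smul_single, smul_eq_mul, mul_one, add_assoc]

theorem monMul_a_polyMon (k : ℤ) (i j : ℕ) (P : ℂ[X]) :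
    monMul q .a (polyMon k i j P) = polyMon (k + 1) i j
      (P * if 0 ≤ k then 1 else 1 - C (qc q ^ (-2 * k)) * X) := by
  induction P using Polynomial.induction_on' with
  | add P Q hP hQ => simp only [map_add, add_mul, hP, hQ]
  | monomial l t =>
    split_ifs with h
    · rw [mul_one, polyMon_monomial, polyMon_monomial]
      simp [monMul, h]
    · rw [mul_sub, mul_one, ← mul_assoc, monomial_mul_C, monomial_mul_X, map_sub,
        polyMon_monomial, polyMon_monomial, polyMon_monomial]
      simp only [monMul, Finsupp.linearCombination_single, h, if_false, smul_sub,
        Finsupp.smul_single, smul_eq_mul, mul_one, add_assoc]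

theorem one_sub_C_mul_X_ne_zero (t : ℂ) : (1 - C t * X : ℂ[X]) ≠ 0 := by
  intro h
  simpa using congrArg (Polynomial.eval 0) h

/-- The element is `a^{*k}`, or `a^{-k}` for negative `k`. Cancelling `a` against `a^*` only
introduces a polynomial factor in `cc^*`; it is nonzero, so nothing is lost because `ℂ[X]` is a
domain. -/
theorem exists_lower (q : Set.Ioo (0 : ℝ) 1) (k : ℤ) : ∃ (x : SUq q) (W : ℤ → ℂ[X]),
    (∀ l, W l ≠ 0) ∧
    ∀ l i j P, leftMul q x (polyMon l i j P) = polyMon (l - k) i j (P * W l) := by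
  induction k using Int.induction_on with
  | zero => exact ⟨1, fun _ => 1, fun _ => one_ne_zero, fun l i j P => by simp⟩
  | succ n ih =>
    obtain ⟨x, W, hW, hx⟩ := ih
    refine ⟨gen q .as * x, fun l => W l *
      if l - n ≤ 0 then 1 else 1 - C (qc q ^ (-2 * ((l - n) - 1))) * X, fun l => ?_,
      fun l i j P => ?_⟩
    · refine mul_ne_zero (hW l) ?_
      split_ifs
      exacts [one_ne_zero, one_sub_C_mul_X_ne_zero _]
    · rw [map_mul, Module.End.mul_apply, hx, leftMul_gen, monMul_as_polyMon, mul_assoc]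
      simp only [sub_sub]
  | pred n ih =>
    obtain ⟨x, W, hW, hx⟩ := ih
    refine ⟨gen q .a * x, fun l => W l *
      if 0 ≤ l - -n then 1 else 1 - C (qc q ^ (-2 * (l - -n))) * X, fun l => ?_,
      fun l i j P => ?_⟩
    · refine mul_ne_zero (hW l) ?_
      split_ifs
      exacts [one_ne_zero, one_sub_C_mul_X_ne_zero _]
    · rw [map_mul, Module.End.mul_apply, hx, leftMul_gen, monMul_a_polyMon, mul_assoc]
      congr 1
      ring_nf

theorem monMul_c_pow_polyMon (k : ℤ) (i j n : ℕ) (P : ℂ[X]) :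
    (monMul q .c ^ n) (polyMon k i j P) = (qc q ^ (-k)) ^ n • polyMon k (i + n) j P := by
  induction n with
  | zero => simp
  | succ n ih =>
    rw [pow_succ', Module.End.mul_apply, ih, map_smul, pow_succ, mul_smul]
    congr 1
    clear ih
    induction P using Polynomial.induction_on' with
    | add P Q hP hQ => simp only [map_add, smul_add, hP, hQ]
    | monomial l t =>
      rw [polyMon_monomial, polyMon_monomial]
      simp only [monMul, Finsupp.linearCombination_single, Finsupp.smul_single, smul_eq_mul]
      congr 1
      · congr 2; ring
      · ring

theorem monMul_cs_pow_polyMon (k : ℤ) (i j n : ℕ) (P : ℂ[X]) :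
    (monMul q .cs ^ n) (polyMon k i j P) = (qc q ^ (-k)) ^ n • polyMon k i (j + n) P := by
  induction n with
  | zero => simp
  | succ n ih =>
    rw [pow_succ', Module.End.mul_apply, ih, map_smul, pow_succ, mul_smul]
    congr 1
    clear ih
    induction P using Polynomial.induction_on' with
    | add P Q hP hQ => simp only [map_add, smul_add, hP, hQ]
    | monomial l t =>
      rw [polyMon_monomial, polyMon_monomial]
      simp only [monMul, Finsupp.linearCombination_single, Finsupp.smul_single, smul_eq_mul]
      congr 1
      · congr 2; ring
      · ring

theorem haarMon_polyMon (k : ℤ) (i j : ℕ) (P : ℂ[X]) :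
    Finsupp.linearCombination ℂ (haarMon q) (polyMon k i j P)
      = if k = 0 ∧ i = j then moment q (X ^ i * P) else 0 := by
  induction P using Polynomial.induction_on' with
  | add P Q hP hQ =>
    simp only [map_add, mul_add, hP, hQ]
    split_ifs <;> simp
  | monomial l t =>
    rw [polyMon_monomial, Finsupp.linearCombination_single, haarMon]
    simp only [add_left_inj]
    split_ifs with h
    · rw [← C_mul_X_pow_eq_monomial, mul_left_comm, ← pow_add, ← smul_eq_C_mul, map_smul,
        moment_X_pow]
    · simp

/-- Take a monomial `(k, i₀, j₀)` occurring in `y`. Left multiplication by suitable elements brings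
the terms with the same `k` and the same `i - j` into the span of the powers of `cc^*` and makes `h`
kill all others. The surviving terms form a nonzero polynomial that would be orthogonal to all
powers of `X` for `moment`. -/
theorem haar_nondegenerate {y : SUq q} (h : ∀ x, haar q (x * y) = 0) : y = 0 := by
  by_contra hy
  have hv : expand q y ≠ 0 := fun h0 => hy (expand_injective q (by rw [h0, map_zero]))
  set v := expand q y with hvdef
  obtain ⟨⟨k, i₀, j₀⟩, hp⟩ := Finsupp.support_nonempty_iff.2 hv
  obtain ⟨x, W, hW, hx⟩ := exists_lower q k
  set S := v.support.filter (fun p => p.1 = k ∧ p.2.1 + j₀ = p.2.2 + i₀) with hS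
  set R : ℂ[X] := ∑ p ∈ S, monomial p.2.1 (v p) with hR
  have hR0 : R ≠ 0 := by
    intro hR0
    have h1 : R.coeff i₀ = 0 := by rw [hR0, coeff_zero]
    have hmem : (k, i₀, j₀) ∈ S := by
      rw [hS, Finset.mem_filter]
      exact ⟨hp, rfl, by simp only; ring⟩
    rw [hR, finsetSum_coeff, Finset.sum_eq_single_of_mem _ hmem, coeff_monomial_same] at h1
    · exact Finsupp.mem_support_iff.1 hp h1
    · rintro ⟨k', i, j⟩ h2 h3
      rw [coeff_monomial, if_neg]
      rintro h4
      simp only [hS, Finset.mem_filter] at h2 h4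
      apply h3
      obtain ⟨-, h5, h6⟩ := h2
      simp only [Prod.mk.injEq]
      refine ⟨h5, h4, by omega⟩
  have hQ : X ^ j₀ * (R * W k) ≠ 0 := mul_ne_zero (pow_ne_zero _ X_ne_zero) (mul_ne_zero hR0 (hW k))
  apply hQ
  apply moment_nondegenerate
  intro r
  -- The exponents are chosen so that `i + r + j₀ = j + r + i₀` holds exactly when `i - j = i₀ -
  -- j₀`; the free `r` supplies the powers `X^r` for `moment_nondegenerate`.
  have h1 := h (gen q .c ^ (r + j₀) * gen q .cs ^ (r + i₀) * x)
  rw [haar, LinearMap.comp_apply, expand_mul, ← hvdef] at h1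
  have h2 : ∀ p : ℤ × ℕ × ℕ, Finsupp.linearCombination ℂ (haarMon q)
      (leftMul q (gen q .c ^ (r + j₀) * gen q .cs ^ (r + i₀) * x) (Finsupp.single p (v p)))
      = if p.1 = k ∧ p.2.1 + j₀ = p.2.2 + i₀ then
        moment q (X ^ r * (X ^ j₀ * (monomial p.2.1 (v p) * W k))) else 0 := by
    rintro ⟨k', i, j⟩
    rw [show Finsupp.single (k', i, j) (v (k', i, j)) = v (k', i, j) • polyMon k' i j 1 by
      rw [polyMon_one, Finsupp.smul_single, smul_eq_mul, mul_one]]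
    simp only [map_mul, map_pow, leftMul_gen, Module.End.mul_apply, map_smul, hx,
      monMul_cs_pow_polyMon, monMul_c_pow_polyMon, haarMon_polyMon, one_mul]
    by_cases h3 : k' = k
    · subst h3
      have h4 : (i + (r + j₀) = j + (r + i₀)) ↔ (i + j₀ = j + i₀) := by omega
      simp only [sub_self, neg_zero, zpow_zero, one_pow, one_smul, true_and, h4, smul_ite,
        smul_zero]
      split_ifs
      · rw [← map_smul, ← C_mul_X_pow_eq_monomial, smul_eq_C_mul]
        congr 1
        ring
      · rfl
    · have h4 : ¬ (k' - k = 0) := by omega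
      simp [h3, h4]
  rw [← Finsupp.sum_single v, Finsupp.sum, map_sum, map_sum, Finset.sum_congr rfl fun p _ => h2 p,
    ← Finset.sum_filter, ← hS] at h1
  rw [hR, Finset.sum_mul, Finset.mul_sum, Finset.mul_sum, map_sum]
  exact h1

/-! ## Weights -/

/-- The elements of `SUq q` on which `K` acts by `q ^ n`. -/
def weight (q : Set.Ioo (0 : ℝ) 1) (n : ℤ) : Submodule ℂ (SUq q) :=
  LinearMap.ker ((actK q).toLinearMap - qc q ^ n • LinearMap.id)

theorem mem_weight {n : ℤ} {x : SUq q} : x ∈ weight q n ↔ actK q x = qc q ^ n • x := by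
  simp [weight, sub_eq_zero]

theorem mem_sphere {x : SUq q} : x ∈ sphere q ↔ x ∈ weight q 0 := by
  rw [mem_weight, zpow_zero, one_smul]
  exact AlgHom.mem_equalizer _ _ _

theorem mul_mem_weight {m n k : ℤ} {x y : SUq q} (hx : x ∈ weight q m) (hy : y ∈ weight q n)
    (hk : m + n = k) : x * y ∈ weight q k := by
  rw [mem_weight] at *
  rw [map_mul, hx, hy, smul_mul_smul_comm, ← hk, zpow_add₀ (qc_ne_zero q)]

theorem actKi_of_mem_weight {n : ℤ} {x : SUq q} (hx : x ∈ weight q n) :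
    actKi q x = qc q ^ (-n) • x := by
  have h := congrArg (actKi q) (mem_weight.1 hx)
  rw [actKi_actK, map_smul] at h
  rw [h, smul_smul, ← zpow_add₀ (qc_ne_zero q), neg_add_cancel, zpow_zero, one_smul, ← h]

theorem actE_mem_weight {n k : ℤ} {x : SUq q} (hx : x ∈ weight q n) (hk : n + 1 = k) :
    actE q x ∈ weight q k := by
  rw [mem_weight] at *
  rw [actK_actE, hx, map_smul, smul_smul, ← hk, zpow_add_one₀ (qc_ne_zero q), mul_comm]

theorem actF_mem_weight {n k : ℤ} {x : SUq q} (hx : x ∈ weight q n) (hk : n - 1 = k) :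
    actF q x ∈ weight q k := by
  rw [mem_weight] at *
  rw [actK_actF, hx, map_smul, smul_smul, ← hk, zpow_sub_one₀ (qc_ne_zero q), mul_comm]

theorem actK_monomialEl (k : ℤ) (i j : ℕ) :
    actK q (monomialEl q (k, i, j)) = qh q ^ (j - i - k : ℤ) • monomialEl q (k, i, j) := by
  have h0 := qh_ne_zero q
  obtain ⟨n, rfl | rfl⟩ := k.eq_nat_or_neg
  · rw [monomialEl_nat]
    simp only [map_mul, map_pow, actK_gen, scaleGen, _root_.smul_pow, smul_mul_smul_comm]
    congr 1
    rw [zpow_sub₀ h0, zpow_sub₀ h0]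
    simp only [zpow_natCast, inv_pow]
    field_simp
  · rw [monomialEl_neg]
    simp only [map_mul, map_pow, actK_gen, scaleGen, _root_.smul_pow, smul_mul_smul_comm]
    congr 1
    rw [zpow_sub₀ h0, zpow_sub₀ h0]
    simp only [zpow_natCast, zpow_neg, inv_pow]
    field_simp

/-- The monomials with `h ≠ 0` have `k = 0` and `i = j`, and `K` fixes these. -/
theorem haar_actK (x : SUq q) : haar q (actK q x) = haar q x := by
  rw [← assemble_expand x]
  induction expand q x using Finsupp.induction_linear with
  | zero => simp
  | add v w hv hw => simp [hv, hw]
  | single p t =>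
    obtain ⟨k, i, j⟩ := p
    rw [assemble, Finsupp.linearCombination_single, map_smul, map_smul, map_smul, actK_monomialEl,
      map_smul]
    have h1 : haar q (monomialEl q (k, i, j)) = haarMon q (k, i, j) := by
      obtain ⟨n, rfl | rfl⟩ := k.eq_nat_or_neg
      · rw [monomialEl_nat, ← mul_assoc, haar_a_c_cs]
      · rw [monomialEl_neg, ← mul_assoc, haar_as_c_cs]
    rw [h1, haarMon]
    split_ifs with h2
    · obtain ⟨h3, h4⟩ := h2
      simp only at h3 h4
      simp [h3, h4]
    · simp

/-- Test `y` against monomials, which are eigenvectors of `K`. If the eigenvalue is not `q^{-n}`,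
then `K`-invariance of `h` already forces the pairing to vanish, so weight `-n` suffices. -/
theorem haar_nondegenerate_weight {n : ℤ} {y : SUq q} (hy : y ∈ weight q n)
    (h : ∀ x ∈ weight q (-n), haar q (x * y) = 0) : y = 0 := by
  apply haar_nondegenerate
  intro x
  rw [← assemble_expand x]
  induction expand q x using Finsupp.induction_linear with
  | zero => simp
  | add v w hv hw => simp [hv, hw, add_mul]
  | single p t =>
    obtain ⟨k, i, j⟩ := p
    rw [assemble, Finsupp.linearCombination_single, smul_mul_assoc, map_smul]
    have h0 := qh_ne_zero q
    by_cases hw : qh q ^ (j - i - k : ℤ) = qc q ^ (-n)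
    · rw [h, smul_zero]
      rw [mem_weight, actK_monomialEl, hw]
    · have h1 := haar_actK (monomialEl q (k, i, j) * y)
      rw [map_mul, actK_monomialEl, mem_weight.1 hy, smul_mul_smul_comm, map_smul,
        smul_eq_mul] at h1
      have h2 : qh q ^ (j - i - k : ℤ) * qc q ^ n ≠ 1 := by
        intro h2
        apply hw
        rw [zpow_neg]
        exact eq_inv_of_mul_eq_one_left h2
      have h3 : (qh q ^ (j - i - k : ℤ) * qc q ^ n - 1) * haar q (monomialEl q (k, i, j) * y) = 0 := by
        rw [sub_mul, one_mul, h1, sub_self]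
      rw [(mul_eq_zero.1 h3).resolve_left (sub_ne_zero.2 h2), smul_zero]

end QSphere

end

noncomputable section

namespace QSphere

variable {q : Set.Ioo (0 : ℝ) 1}

open Form

/-! ## The relations of the exterior algebra -/

theorem Form.sum_eq {M : Type*} [AddCommMonoid M] (f : Form → M) :
    ∑ a, f a = f minus + f z + f plus + f zero := by
  change ∑ a ∈ {minus, z, plus, zero}, f a = _
  rw [Finset.sum_insert (by simp), Finset.sum_insert (by simp), Finset.sum_insert (by simp),
    Finset.sum_singleton]
  simp only [add_assoc]

theorem sum_words_two {M : Type*} [AddCommMonoid M] (f : (Fin 2 → Form) → M) :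
    ∑ w, f w = ∑ a, ∑ b, f ![a, b] := by
  rw [← Fintype.sum_prod_type']
  exact Fintype.sum_equiv (finTwoArrowEquiv Form) _ _ fun w => by
    congr 1
    ext i
    fin_cases i <;> rfl

theorem sum_words_three {M : Type*} [AddCommMonoid M] (f : (Fin 3 → Form) → M) :
    ∑ w, f w = ∑ a, ∑ b, ∑ d, f ![a, b, d] := by
  rw [← (Fin.consEquiv fun _ : Fin 3 => Form).sum_comp, Fintype.sum_prod_type]
  refine Finset.sum_congr rfl fun a _ => ?_
  rw [sum_words_two]
  rfl

theorem braidAt_two (c : (Fin 2 → Form) → ℂ) (n k : Form) :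
    braidAt q 2 0 c ![n, k] = ∑ a, ∑ b, sigma q a b n k * c ![a, b] := by
  simp only [braidAt, zero_add, show (1 < 2) from one_lt_two, dif_pos,
    LinearMap.pi_apply, LinearMap.sum_apply, LinearMap.smul_apply, LinearMap.proj_apply,
    smul_eq_mul]
  refine Finset.sum_congr rfl fun a _ => Finset.sum_congr rfl fun b _ => ?_
  congr 2
  ext i
  fin_cases i <;> rfl

theorem braidAt_three_zero (c : (Fin 3 → Form) → ℂ) (n k l : Form) :
    braidAt q 3 0 c ![n, k, l] = ∑ a, ∑ b, sigma q a b n k * c ![a, b, l] := by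
  simp only [braidAt, zero_add, show (1 < 3) by norm_num, dif_pos,
    LinearMap.pi_apply, LinearMap.sum_apply, LinearMap.smul_apply, LinearMap.proj_apply,
    smul_eq_mul]
  refine Finset.sum_congr rfl fun a _ => Finset.sum_congr rfl fun b _ => ?_
  congr 2
  ext i
  fin_cases i <;> rfl

theorem braidAt_three_one (c : (Fin 3 → Form) → ℂ) (n k l : Form) :
    braidAt q 3 1 c ![n, k, l] = ∑ a, ∑ b, sigma q a b k l * c ![n, a, b] := by
  simp only [braidAt, show (1 + 1 < 3) by norm_num, dif_pos,
    LinearMap.pi_apply, LinearMap.sum_apply, LinearMap.smul_apply, LinearMap.proj_apply,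
    smul_eq_mul]
  refine Finset.sum_congr rfl fun a _ => Finset.sum_congr rfl fun b _ => ?_
  congr 2
  ext i
  fin_cases i <;> rfl

theorem antisym_two_eq_zero_iff (c : (Fin 2 → Form) → ℂ) :
    antisym q 2 c = 0 ↔ ∀ n k, c ![n, k] = ∑ a, ∑ b, sigma q a b n k * c ![a, b] := by
  have h : antisym q 2 c = c - braidAt q 2 0 c := by
    simp [antisym, antisymAux, cosetSum]
  rw [h, sub_eq_zero]
  constructor
  · intro h1 n k
    rw [← braidAt_two, ← h1]
  · intro h1
    ext w
    have : w = ![w 0, w 1] := by ext i; fin_cases i <;> rfl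
    rw [this, braidAt_two]
    exact h1 _ _

/-- The quadratic relations of the exterior algebra of left invariant forms. -/
structure Quadratic (q : Set.Ioo (0 : ℝ) 1) {A : Type*} [Ring A] [Algebra ℂ A] (w : Form → A) :
    Prop where
  mm : w minus * w minus = 0
  pp : w plus * w plus = 0
  oo : w zero * w zero = 0
  pm : w plus * w minus = -(w minus * w plus)
  om : w zero * w minus = -(w minus * w zero)
  op : w zero * w plus = -(w plus * w zero)
  zm : w z * w minus = -((qc q ^ 2)⁻¹ • (w minus * w z))
  zp : w z * w plus = -(qc q ^ 2 • (w plus * w z))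
  zz : w z * w z = -((qc q ^ 2 - (qc q ^ 2)⁻¹) • (w minus * w plus))
  oz : w zero * w z = -(w z * w zero) + (qc q - (qc q)⁻¹) ^ 2 • (w minus * w plus)

/-- Reordering by the quadratic relations leaves six products, and the coefficient of each is a
combination of entries of the equation `c = σ c`. -/
theorem sum_wedge_two_of_quadratic {A : Type*} [Ring A] [Algebra ℂ A] {w : Form → A}
    (hw : Quadratic q w) {c : (Fin 2 → Form) → ℂ} (hc : antisym q 2 c = 0) :
    ∑ a, ∑ b, c ![a, b] • (w a * w b) = 0 := by
  have h0 := qc_ne_zero q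
  rw [antisym_two_eq_zero_iff] at hc
  have e1 := hc z zero
  have e2 := hc zero z
  have e3 := hc z minus
  have e4 := hc z plus
  have e5 := hc zero minus
  have e6 := hc zero plus
  simp [Form.sum_eq, sigma, ten] at e1 e2 e3 e4 e5 e6
  simp only [Form.sum_eq, hw.mm, hw.pp, hw.oo, hw.pm, hw.om, hw.op, hw.zm, hw.zp, hw.zz, hw.oz]
  -- The entry `(zero, z)` says that `c` agrees at `(zero, z)` and `(z, zero)`; the multiple of it
  -- eliminates `c ![z, zero]` from the entry `(z, zero)`.
  have f1 : c ![minus, plus] - c ![plus, minus] - (qc q ^ 2 - (qc q ^ 2)⁻¹) * c ![z, z]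
      + (qc q - (qc q)⁻¹) ^ 2 * c ![zero, z] = 0 := by
    linear_combination e1 + (1 + (qc q - (qc q)⁻¹) ^ 2) * e2
  have f2 : c ![minus, z] - (qc q ^ 2)⁻¹ * c ![z, minus] = 0 := by
    linear_combination -e3
  have f3 : c ![plus, z] - qc q ^ 2 * c ![z, plus] = 0 := by
    linear_combination -e4
  linear_combination (norm := skip) f1 • (w minus * w plus) + f2 • (w minus * w z)
    + f3 • (w plus * w z) + (-e2) • (w z * w zero) + (-e5) • (w minus * w zero)
    + (-e6) • (w plus * w zero)
  match_scalars <;> field_simp <;> ring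

/-- The antisymmetriser factors as `(1 - σ₁ + σ₀σ₁)(1 - σ₀)`. Naming `u = (1 - σ₀) c` lets the two
factors be expanded one after the other. -/
theorem antisym_three_apply (c : (Fin 3 → Form) → ℂ) (n k l : Form) : ∃ u : (Fin 3 → Form) → ℂ,
    (∀ n k l, u ![n, k, l] = c ![n, k, l] - ∑ a, ∑ b, sigma q a b n k * c ![a, b, l]) ∧
    antisym q 3 c ![n, k, l] = u ![n, k, l] - ∑ a, ∑ b, sigma q a b k l * u ![n, a, b]
      + ∑ a, ∑ b, sigma q a b n k * ∑ d, ∑ e, sigma q d e b l * u ![a, d, e] := by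
  refine ⟨c - braidAt q 3 0 c, fun n k l => by rw [Pi.sub_apply, braidAt_three_zero], ?_⟩
  have h : antisym q 3 c = (c - braidAt q 3 0 c) - braidAt q 3 1 (c - braidAt q 3 0 c)
      + braidAt q 3 0 (braidAt q 3 1 (c - braidAt q 3 0 c)) := by
    simp only [antisym, antisymAux, cosetSum, Nat.reduceSub, one_mul, mul_one,
      Module.End.mul_apply, LinearMap.sub_apply, Module.End.one_apply]
    abel
  rw [h, Pi.add_apply, Pi.sub_apply, braidAt_three_zero, braidAt_three_one]
  simp only [braidAt_three_one]

/-- These are the entries of `antisym q 3 c` at `(-,+,0)`, `(-,+,z)`, `(-,z,0)`, `(z,+,0)`. Up to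
sign and a power of `q²` they are the coefficients that remain when a cubic tensor is reordered by
the quadratic relations, which is why four entries suffice. -/
theorem antisym_three_eq_zero {c : (Fin 3 → Form) → ℂ} (hc : antisym q 3 c = 0) :
    c ![minus, plus, zero] - c ![minus, zero, plus]
      - (qc q ^ 2 - (qc q ^ 2)⁻¹) * c ![z, z, zero] + (qc q ^ 2 - (qc q ^ 2)⁻¹) * c ![z, zero, z]
      - c ![plus, minus, zero] + c ![plus, zero, minus] + c ![zero, minus, plus]
      - (qc q ^ 2 - (qc q ^ 2)⁻¹) * c ![zero, z, z] + (qc q - (qc q)⁻¹) ^ 2 * c ![zero, z, zero]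
      - c ![zero, plus, minus] = 0 ∧
    -(qc q ^ 2) * c ![minus, z, plus] + c ![minus, plus, z] + c ![z, minus, plus]
      - (qc q ^ 2 - (qc q ^ 2)⁻¹) * c ![z, z, z] - c ![z, plus, minus]
      + (qc q - (qc q)⁻¹) ^ 2 * c ![z, zero, z] - c ![plus, minus, z]
      + (qc q ^ 2)⁻¹ * c ![plus, z, minus] = 0 ∧
    qc q ^ 2 * c ![minus, z, zero] - qc q ^ 2 * c ![minus, zero, z] - c ![z, minus, zero]
      + c ![z, zero, minus] + qc q ^ 2 * c ![zero, minus, z] - c ![zero, z, minus] = 0 ∧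
    c ![z, plus, zero] - c ![z, zero, plus] - (qc q ^ 2)⁻¹ * c ![plus, z, zero]
      + (qc q ^ 2)⁻¹ * c ![plus, zero, z] + c ![zero, z, plus]
      - (qc q ^ 2)⁻¹ * c ![zero, plus, z] = 0 := by
  have h0 := qc_ne_zero q
  refine ⟨?_, ?_, ?_, ?_⟩
  · obtain ⟨u, hu, h1⟩ := antisym_three_apply (q := q) c minus plus zero
    rw [hc, Pi.zero_apply] at h1
    simp [Form.sum_eq, sigma, ten] at h1
    simp [hu, Form.sum_eq, sigma, ten] at h1
    linear_combination (norm := skip) -h1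
    field_simp
    ring
  · obtain ⟨u, hu, h1⟩ := antisym_three_apply (q := q) c minus plus z
    rw [hc, Pi.zero_apply] at h1
    simp [Form.sum_eq, sigma, ten] at h1
    simp [hu, Form.sum_eq, sigma, ten] at h1
    linear_combination (norm := skip) -h1
    field_simp
    ring
  · obtain ⟨u, hu, h1⟩ := antisym_three_apply (q := q) c minus z zero
    rw [hc, Pi.zero_apply] at h1
    simp [Form.sum_eq, sigma, ten] at h1
    simp [hu, Form.sum_eq, sigma, ten] at h1
    linear_combination (norm := skip) -h1
    field_simp
    ring
  · obtain ⟨u, hu, h1⟩ := antisym_three_apply (q := q) c z plus zero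
    rw [hc, Pi.zero_apply] at h1
    simp [Form.sum_eq, sigma, ten] at h1
    simp [hu, Form.sum_eq, sigma, ten] at h1
    linear_combination (norm := skip) -h1
    field_simp
    ring

theorem sum_wedge_three_of_quadratic {A : Type*} [Ring A] [Algebra ℂ A] {w : Form → A}
    (hw : Quadratic q w) {c : (Fin 3 → Form) → ℂ} (hc : antisym q 3 c = 0) :
    ∑ a, ∑ b, ∑ d, c ![a, b, d] • (w a * (w b * w d)) = 0 := by
  have h0 := qc_ne_zero q
  obtain ⟨e1, e2, e3, e4⟩ := antisym_three_eq_zero hc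
  have mm (x : A) : w minus * (w minus * x) = 0 := by rw [← mul_assoc, hw.mm, zero_mul]
  have pp (x : A) : w plus * (w plus * x) = 0 := by rw [← mul_assoc, hw.pp, zero_mul]
  have pm (x : A) : w plus * (w minus * x) = -(w minus * (w plus * x)) := by
    rw [← mul_assoc, hw.pm, neg_mul, mul_assoc]
  have om (x : A) : w zero * (w minus * x) = -(w minus * (w zero * x)) := by
    rw [← mul_assoc, hw.om, neg_mul, mul_assoc]
  have op (x : A) : w zero * (w plus * x) = -(w plus * (w zero * x)) := by
    rw [← mul_assoc, hw.op, neg_mul, mul_assoc]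
  have zm (x : A) : w z * (w minus * x) = -((qc q ^ 2)⁻¹ • (w minus * (w z * x))) := by
    rw [← mul_assoc, hw.zm, neg_mul, smul_mul_assoc, mul_assoc]
  have zp (x : A) : w z * (w plus * x) = -(qc q ^ 2 • (w plus * (w z * x))) := by
    rw [← mul_assoc, hw.zp, neg_mul, smul_mul_assoc, mul_assoc]
  have zz (x : A) : w z * (w z * x)
      = -((qc q ^ 2 - (qc q ^ 2)⁻¹) • (w minus * (w plus * x))) := by
    rw [← mul_assoc, hw.zz, neg_mul, smul_mul_assoc, mul_assoc]
  have oz (x : A) : w zero * (w z * x) = -(w z * (w zero * x))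
      + (qc q - (qc q)⁻¹) ^ 2 • (w minus * (w plus * x)) := by
    rw [← mul_assoc, hw.oz, add_mul, neg_mul, smul_mul_assoc, mul_assoc, mul_assoc]
  simp only [Form.sum_eq, hw.mm, hw.pp, hw.oo, hw.pm, hw.om, hw.op, hw.zm, hw.zp, hw.zz, hw.oz,
    mm, pp, pm, om, op, zm, zp, zz, oz, mul_neg, mul_smul_comm, mul_add, mul_zero, smul_neg,
    smul_zero, neg_zero, add_zero, zero_add, neg_neg]
  linear_combination (norm := skip) e1 • (w minus * (w plus * w zero))
    + e2 • (w minus * (w plus * w z)) + ((qc q ^ 2)⁻¹ * e3) • (w minus * (w z * w zero))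
    - (qc q ^ 2 * e4) • (w plus * (w z * w zero))
  match_scalars <;> field_simp <;> ring

end QSphere

end

/-! ### Covariance of the quadratic relations under the bimodule matrix `f`. -/

noncomputable section

namespace QSphere

variable {q : Set.Ioo (0 : ℝ) 1}

open Form

/-- Elements satisfying the relations of `U_q(su(2))`. -/
structure UqRel (q : Set.Ioo (0 : ℝ) 1) {A : Type*} [Ring A] [Algebra ℂ A] (K Ki E F : A) :
    Prop where
  K_Ki : K * Ki = 1
  Ki_K : Ki * K = 1
  K_E : K * E = qc q • (E * K)
  K_F : K * F = (qc q)⁻¹ • (F * K)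
  Ki_E : Ki * E = (qc q)⁻¹ • (E * Ki)
  Ki_F : Ki * F = qc q • (F * Ki)
  E_F : E * F = F * E + (qc q - (qc q)⁻¹)⁻¹ • (K * K - Ki * Ki)

/-- The matrix `f` of the bimodule structure, in terms of generators of `U_q(su(2))`. -/
def fUq (q : Set.Ioo (0 : ℝ) 1) {A : Type*} [Ring A] [Algebra ℂ A] (K Ki E F : A) :
    Form → Form → A
  | minus, minus => 1
  | minus, zero => (qh q)⁻¹ • (K * E)
  | z, minus => ((qc q - (qc q)⁻¹) * qh q) • (F * Ki)
  | z, z => Ki * Ki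
  | z, plus => ((qc q - (qc q)⁻¹) * (qh q)⁻¹) • (E * Ki)
  | z, zero => (qc q - (qc q)⁻¹) • (F * E
      + ((qc q)⁻¹ * ((qc q - (qc q)⁻¹) ^ 2)⁻¹) • (Ki * Ki - K * K))
  | plus, plus => 1
  | plus, zero => (qh q)⁻¹ • (F * K)
  | zero, zero => K * K
  | _, _ => 0

/-- A scalar model of the left invariant forms commutes with functions, whereas the true `ω_a` do
not. Combining the model with `f` repairs this, and the quadratic relations survive: bring the
quantum group elements to the order `F`, `E`, `K^{±1}` and the forms to normal order, then compare
coefficients. -/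
theorem Quadratic.twist {A : Type*} [Ring A] [Algebra ℂ A] {K Ki E F : A}
    (hU : UqRel q K Ki E F) {l : Form → A} (hl : Quadratic q l) (hK : ∀ a, l a * K = K * l a)
    (hKi : ∀ a, l a * Ki = Ki * l a) (hE : ∀ a, l a * E = E * l a)
    (hF : ∀ a, l a * F = F * l a) :
    Quadratic q fun a => ∑ b, fUq q K Ki E F a b * l b := by
  have h0 := qh_ne_zero q
  have h4 : qh q ^ 4 - 1 ≠ 0 := by
    rw [sub_ne_zero, show qh q ^ 4 = qc q ^ 2 by rw [← qh_sq]; ring]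
    exact qc_lt_one_ne q two_ne_zero
  have hK' (a : Form) (x : A) : l a * (K * x) = K * (l a * x) := by
    rw [← mul_assoc, hK, mul_assoc]
  have hKi' (a : Form) (x : A) : l a * (Ki * x) = Ki * (l a * x) := by
    rw [← mul_assoc, hKi, mul_assoc]
  have hE' (a : Form) (x : A) : l a * (E * x) = E * (l a * x) := by
    rw [← mul_assoc, hE, mul_assoc]
  have hF' (a : Form) (x : A) : l a * (F * x) = F * (l a * x) := by
    rw [← mul_assoc, hF, mul_assoc]
  have u1 (x : A) : K * (Ki * x) = x := by rw [← mul_assoc, hU.K_Ki, one_mul]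
  have u2 (x : A) : Ki * (K * x) = x := by rw [← mul_assoc, hU.Ki_K, one_mul]
  have u3 (x : A) : K * (E * x) = qc q • (E * (K * x)) := by
    rw [← mul_assoc, hU.K_E, smul_mul_assoc, mul_assoc]
  have u4 (x : A) : K * (F * x) = (qc q)⁻¹ • (F * (K * x)) := by
    rw [← mul_assoc, hU.K_F, smul_mul_assoc, mul_assoc]
  have u5 (x : A) : Ki * (E * x) = (qc q)⁻¹ • (E * (Ki * x)) := by
    rw [← mul_assoc, hU.Ki_E, smul_mul_assoc, mul_assoc]
  have u6 (x : A) : Ki * (F * x) = qc q • (F * (Ki * x)) := by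
    rw [← mul_assoc, hU.Ki_F, smul_mul_assoc, mul_assoc]
  have u7 (x : A) : E * (F * x) = F * (E * x)
      + (qc q - (qc q)⁻¹)⁻¹ • (K * (K * x) - Ki * (Ki * x)) := by
    rw [← mul_assoc, hU.E_F, add_mul, smul_mul_assoc, sub_mul]
    simp only [mul_assoc]
  constructor
  all_goals
    simp only [Form.sum_eq, fUq, zero_mul, add_zero, zero_add, one_mul, add_mul, mul_add,
      smul_mul_assoc, mul_smul_comm, mul_assoc, sub_mul, mul_sub, smul_add, smul_sub, smul_smul,
      hK', hKi', hE', hF',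
      hl.mm, hl.pp, hl.oo, hl.pm, hl.om, hl.op, hl.zm, hl.zp, hl.zz, hl.oz,
      mul_neg, mul_zero, smul_neg, smul_zero, u1, u2, u3, u4, u5, u6, u7, sub_self]
  all_goals
    match_scalars
  all_goals try simp only [← qh_sq]
  all_goals try field_simp
  all_goals try ring

end QSphere

end

noncomputable section

namespace QSphere

variable {q : Set.Ioo (0 : ℝ) 1}

open Form

/-! ## The action of `U_q(su(2))` by operators -/

theorem uqRel_act (q : Set.Ioo (0 : ℝ) 1) :
    UqRel q (actK q).toLinearMap (actKi q).toLinearMap (actE q) (actF q) where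
  K_Ki := LinearMap.ext fun x => actK_actKi x
  Ki_K := LinearMap.ext fun x => actKi_actK x
  K_E := LinearMap.ext fun x => actK_actE x
  K_F := LinearMap.ext fun x => actK_actF x
  Ki_E := LinearMap.ext fun x => actKi_actE x
  Ki_F := LinearMap.ext fun x => actKi_actF x
  E_F := LinearMap.ext fun x => actE_actF x

theorem fmat_eq_fUq (a b : Form) :
    fmat q a b = fUq q (actK q).toLinearMap (actKi q).toLinearMap (actE q) (actF q) a b := by
  cases a <;> cases b <;> rfl

/-- This is the coproduct `Δ f_{ab} = ∑_d f_{ad} ⊗ f_{db}`, the property that makes the bimodule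
relation hold in the representation. -/
theorem fmat_mul (a b : Form) (x y : SUq q) :
    fmat q a b (x * y) = ∑ d, fmat q a d x * fmat q d b y := by
  have h0 := qh_ne_zero q
  have h1 := qc_ne_zero q
  cases a <;> cases b <;>
    simp [Form.sum_eq, fmat, actE_mul, actF_mul, actK_actE, actKi_actE]
  all_goals try simp only [mul_add, add_mul, mul_sub, sub_mul, smul_sub, smul_mul_assoc,
      mul_smul_comm, smul_smul]
  all_goals match_scalars
  all_goals try simp only [← qh_sq]
  all_goals try field_simp
  all_goals try ring

/-! ## A representation of the exterior algebra -/

/-- The universal property of `OmegaSU q`. -/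
def liftOmega {B : Type} [Ring B] [Algebra ℂ B] (φ : SUq q →ₐ[ℂ] B) (w : Form → B)
    (hbim : ∀ a x, w a * φ x = ∑ b, φ (fmat q a b x) * w b)
    (hwedge : ∀ (k : ℕ) (c : (Fin k → Form) → ℂ), antisym q k c = 0 →
      ∑ v : Fin k → Form, c v • (List.ofFn fun i => w (v i)).prod = 0) : OmegaSU q →ₐ[ℂ] B :=
  RingQuot.liftAlgHom ℂ ⟨FreeAlgebra.lift ℂ (Sum.elim φ w), by
    intro x y hxy
    cases hxy with
    | scalar t => simp
    | add x y => simp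
    | mul x y => simp
    | bimodule a x => simpa using hbim a x
    | wedge k c hc =>
      simp only [map_sum, map_smul, map_list_prod, List.map_ofFn, map_zero]
      rw [← hwedge k c hc]
      simp [Function.comp_def]⟩

section
variable {B : Type} [Ring B] [Algebra ℂ B] (φ : SUq q →ₐ[ℂ] B) (w : Form → B)
    (hbim : ∀ a x, w a * φ x = ∑ b, φ (fmat q a b x) * w b)
    (hwedge : ∀ (k : ℕ) (c : (Fin k → Form) → ℂ), antisym q k c = 0 →
      ∑ v : Fin k → Form, c v • (List.ofFn fun i => w (v i)).prod = 0)

theorem liftOmega_inc (x : SUq q) : liftOmega φ w hbim hwedge (inc q x) = φ x := by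
  refine (RingQuot.liftAlgHom_mkAlgHom_apply ℂ (FreeAlgebra.lift ℂ (Sum.elim φ w)) _
    (FreeAlgebra.ι ℂ (Sum.inl x))).trans ?_
  simp

theorem liftOmega_omega (a : Form) : liftOmega φ w hbim hwedge (omega q a) = w a := by
  refine (RingQuot.liftAlgHom_mkAlgHom_apply ℂ (FreeAlgebra.lift ℂ (Sum.elim φ w)) _
    (FreeAlgebra.ι ℂ (Sum.inr a))).trans ?_
  simp

end

/-- The wedge relations in degrees `0`, `1`, `2`, `3` follow from the quadratic ones. -/
theorem wedge_of_quadratic {A : Type*} [Ring A] [Algebra ℂ A] {w : Form → A}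
    (hw : Quadratic q w) {k : ℕ} (hk : k ≤ 3) {c : (Fin k → Form) → ℂ} (hc : antisym q k c = 0) :
    ∑ v : Fin k → Form, c v • (List.ofFn fun i => w (v i)).prod = 0 := by
  interval_cases k
  · have : c = 0 := by simpa [antisym, antisymAux] using hc
    simp [this]
  · have : c = 0 := by simpa [antisym, antisymAux] using hc
    simp [this]
  · rw [sum_words_two, ← sum_wedge_two_of_quadratic hw hc]
    simp
  · rw [sum_words_three, ← sum_wedge_three_of_quadratic hw hc]
    simp

/-- The coefficient of `ω_- ∧ ω_+ ∧ ω_0` in `ω_a ∧ ω_b ∧ ω_d`. -/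
def topCoeff (q : Set.Ioo (0 : ℝ) 1) : Form → Form → Form → ℂ
  | minus, plus, zero => 1
  | minus, zero, plus => -1
  | plus, minus, zero => -1
  | plus, zero, minus => 1
  | zero, minus, plus => 1
  | zero, plus, minus => -1
  | z, z, zero => -(qc q ^ 2 - (qc q ^ 2)⁻¹)
  | z, zero, z => qc q ^ 2 - (qc q ^ 2)⁻¹
  | zero, z, z => -(qc q ^ 2 - (qc q ^ 2)⁻¹)
  | zero, z, zero => (qc q - (qc q)⁻¹) ^ 2
  | _, _, _ => 0

/-- The index set of a basis of a graded module over the algebra of left invariant forms, in which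
the volume form acts from degree `0` to degree `3`. -/
inductive Level
  | bot
  | one (a : Form)
  | two (a : Form)
  | top
  deriving DecidableEq

namespace Level

/-- Levels as a disjoint sum. -/
def equivSum : Unit ⊕ Form ⊕ Form ⊕ Unit ≃ Level where
  toFun
    | .inl _ => bot
    | .inr (.inl a) => one a
    | .inr (.inr (.inl a)) => two a
    | .inr (.inr (.inr _)) => top
  invFun
    | bot => .inl ()
    | one a => .inr (.inl a)
    | two a => .inr (.inr (.inl a))
    | top => .inr (.inr (.inr ()))
  left_inv x := by rcases x with _ | _ | _ | _ <;> rfl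
  right_inv x := by cases x <;> rfl

instance : Fintype Level := Fintype.ofEquiv _ equivSum

theorem sum_eq {M : Type*} [AddCommMonoid M] (f : Level → M) :
    ∑ n, f n = f bot + (∑ a, f (one a) + (∑ a, f (two a) + f top)) := by
  rw [← equivSum.sum_comp]
  simp [Fintype.sum_sum_type, equivSum]

/-- The degree of a level. -/
def deg : Level → ℕ
  | bot => 0
  | one _ => 1
  | two _ => 2
  | top => 3

theorem deg_le (n : Level) : n.deg ≤ 3 := by cases n <;> simp [deg]

end Level

open Level

/-- The action of `ω_a` on the graded module. -/
def levelMul (q : Set.Ioo (0 : ℝ) 1) (a : Form) : Matrix Level Level ℂ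
  | one b, bot => if a = b then 1 else 0
  | two b, one d => topCoeff q b a d
  | top, two b => if a = b then 1 else 0
  | _, _ => 0

/-- A vector of degree two is recorded by its pairings: its coordinate at `two d` is the coefficient
of `top` after multiplication by `ω_d`. Hence `topCoeff` is the only structure constant needed. -/
theorem levelMul_mul_two_bot (a b d : Form) :
    (levelMul q a * levelMul q b) (two d) bot = topCoeff q d a b := by
  simp [Matrix.mul_apply, Level.sum_eq, levelMul]

theorem levelMul_mul_top_one (a b d : Form) :
    (levelMul q a * levelMul q b) top (one d) = topCoeff q a b d := by
  simp [Matrix.mul_apply, Level.sum_eq, levelMul]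

theorem levelMul_ext {A B : Matrix Level Level ℂ} (hA : ∀ n m, n.deg ≠ m.deg + 2 → A n m = 0)
    (hB : ∀ n m, n.deg ≠ m.deg + 2 → B n m = 0) (h1 : ∀ d, A (two d) bot = B (two d) bot)
    (h2 : ∀ d, A top (one d) = B top (one d)) : A = B := by
  ext n m
  by_cases h : n.deg = m.deg + 2
  · cases n <;> cases m <;> simp [Level.deg] at h
    · exact h1 _
    · exact h2 _
  · rw [hA n m h, hB n m h]

/-- The matrix `A` raises degrees by `k`. -/
def Raises {R : Type*} [Zero R] (k : ℕ) (A : Matrix Level Level R) : Prop :=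
  ∀ n m, n.deg ≠ m.deg + k → A n m = 0

theorem Raises.mul {R : Type*} [Semiring R] {k l : ℕ} {A B : Matrix Level Level R}
    (hA : Raises k A) (hB : Raises l B) : Raises (k + l) (A * B) := by
  intro n m h
  rw [Matrix.mul_apply]
  refine Finset.sum_eq_zero fun r _ => ?_
  by_cases h1 : n.deg = r.deg + k
  · rw [hB r m (by omega), mul_zero]
  · rw [hA n r h1, zero_mul]

theorem Raises.eq_zero {R : Type*} [Zero R] {k : ℕ} {A : Matrix Level Level R}
    (hA : Raises k A) (hk : 4 ≤ k) : A = 0 := by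
  ext n m
  exact hA n m (by have := n.deg_le; omega)

theorem raises_levelMul (a : Form) : Raises 1 (levelMul q a) := by
  intro n m h
  cases n <;> cases m <;> simp [levelMul, Level.deg] at h ⊢

/-- A product of two forms has nonzero entries only from degree `0` to `2` and from `1` to `3`. The
relations therefore amount to identities for `topCoeff` in its last two and in its first two
arguments. -/
theorem quadratic_levelMul (q : Set.Ioo (0 : ℝ) 1) : Quadratic q (levelMul q) := by
  have h0 := qc_ne_zero q
  have hr (a b : Form) : Raises 2 (levelMul q a * levelMul q b) :=
    (raises_levelMul a).mul (raises_levelMul b)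
  constructor
  all_goals
    apply levelMul_ext
    · exact hr _ _
    · intro n m h
      simp [hr _ _ n m h]
    all_goals
      intro d
      simp only [Matrix.zero_apply, Matrix.neg_apply, Matrix.add_apply, Matrix.smul_apply,
        levelMul_mul_two_bot, levelMul_mul_top_one]
      cases d <;> simp [topCoeff]

theorem Quadratic.map {A B : Type*} [Ring A] [Algebra ℂ A] [Ring B] [Algebra ℂ B]
    {w : Form → A} (hw : Quadratic q w) (ψ : A →ₐ[ℂ] B) : Quadratic q fun a => ψ (w a) where
  mm := by rw [← map_mul, hw.mm, map_zero]
  pp := by rw [← map_mul, hw.pp, map_zero]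
  oo := by rw [← map_mul, hw.oo, map_zero]
  pm := by simp only [← map_mul, hw.pm, map_neg]
  om := by simp only [← map_mul, hw.om, map_neg]
  op := by simp only [← map_mul, hw.op, map_neg]
  zm := by simp only [← map_mul, hw.zm, map_neg, map_smul]
  zp := by simp only [← map_mul, hw.zp, map_neg, map_smul]
  zz := by simp only [← map_mul, hw.zz, map_neg, map_smul]
  oz := by simp only [← map_mul, hw.oz, map_add, map_neg, map_smul]

theorem UqRel.map {A B : Type*} [Ring A] [Algebra ℂ A] [Ring B] [Algebra ℂ B]
    {K Ki E F : A} (h : UqRel q K Ki E F) (ψ : A →ₐ[ℂ] B) :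
    UqRel q (ψ K) (ψ Ki) (ψ E) (ψ F) where
  K_Ki := by rw [← map_mul, h.K_Ki, map_one]
  Ki_K := by rw [← map_mul, h.Ki_K, map_one]
  K_E := by rw [← map_mul, h.K_E, map_smul, map_mul]
  K_F := by rw [← map_mul, h.K_F, map_smul, map_mul]
  Ki_E := by rw [← map_mul, h.Ki_E, map_smul, map_mul]
  Ki_F := by rw [← map_mul, h.Ki_F, map_smul, map_mul]
  E_F := by rw [← map_mul, h.E_F, map_add, map_smul, map_sub, map_mul, map_mul, map_mul]

theorem map_fUq {A B : Type*} [Ring A] [Algebra ℂ A] [Ring B] [Algebra ℂ B]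
    (K Ki E F : A) (ψ : A →ₐ[ℂ] B) (a b : Form) :
    ψ (fUq q K Ki E F a b) = fUq q (ψ K) (ψ Ki) (ψ E) (ψ F) a b := by
  cases a <;> cases b <;> simp [fUq]

/-- The matrices over the operators on `SUq q`. -/
abbrev OpMatrix (q : Set.Ioo (0 : ℝ) 1) : Type :=
  Matrix Level Level (Module.End ℂ (SUq q))

/-- The operator `X` in every degree. -/
def diagOp (q : Set.Ioo (0 : ℝ) 1) : Module.End ℂ (SUq q) →ₐ[ℂ] OpMatrix q :=
  Matrix.scalarAlgHom Level ℂ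

/-- The action of left invariant forms by scalar matrices. -/
def formOp (q : Set.Ioo (0 : ℝ) 1) (a : Form) : OpMatrix q :=
  (Algebra.ofId ℂ (Module.End ℂ (SUq q))).mapMatrix (levelMul q a)

theorem formOp_apply (a : Form) (n m : Level) :
    formOp q a n m = algebraMap ℂ _ (levelMul q a n m) := rfl

theorem diagOp_mul_apply (X : Module.End ℂ (SUq q)) (A : OpMatrix q) (n m : Level) :
    (diagOp q X * A) n m = X * A n m := by
  simp [diagOp, Matrix.scalar_apply]

theorem formOp_mul_diagOp (a : Form) (X : Module.End ℂ (SUq q)) :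
    formOp q a * diagOp q X = diagOp q X * formOp q a := by
  ext1 n m
  rw [diagOp_mul_apply, formOp_apply, ← Algebra.commutes]
  simp [diagOp, Matrix.scalar_apply, formOp_apply]

/-- The action of the one-form `ω_a`. -/
def omegaOp (q : Set.Ioo (0 : ℝ) 1) (a : Form) : OpMatrix q :=
  ∑ b, diagOp q (fmat q a b) * formOp q b

theorem quadratic_formOp (q : Set.Ioo (0 : ℝ) 1) : Quadratic q (formOp q) :=
  (quadratic_levelMul q).map _

theorem quadratic_omegaOp (q : Set.Ioo (0 : ℝ) 1) : Quadratic q (omegaOp q) := by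
  have h := Quadratic.twist ((uqRel_act q).map (diagOp q)) (quadratic_formOp q)
    (fun a => formOp_mul_diagOp a _) (fun a => formOp_mul_diagOp a _)
    (fun a => formOp_mul_diagOp a _) (fun a => formOp_mul_diagOp a _)
  rw [show omegaOp q = fun a => ∑ b, diagOp q (fmat q a b) * formOp q b from rfl]
  simpa only [← map_fUq, ← fmat_eq_fUq] using h

theorem raises_omegaOp (a : Form) : Raises 1 (omegaOp q a) := by
  intro n m h
  rw [omegaOp, Matrix.sum_apply]
  refine Finset.sum_eq_zero fun b _ => ?_
  rw [diagOp_mul_apply, formOp_apply, raises_levelMul b n m h, map_zero, mul_zero]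

theorem raises_list_prod {R : Type*} [Semiring R] (l : List (Matrix Level Level R))
    (h : ∀ A ∈ l, Raises 1 A) : Raises l.length l.prod := by
  induction l with
  | nil =>
    intro n m hnm
    rw [List.prod_nil, Matrix.one_apply_ne]
    rintro rfl
    exact hnm rfl
  | cons A l ih =>
    rw [List.prod_cons, List.length_cons, add_comm]
    exact (h A (by simp)).mul (ih fun B hB => h B (by simp [hB]))

/-- The action of functions by left multiplication. -/
def funcOp (q : Set.Ioo (0 : ℝ) 1) : SUq q →ₐ[ℂ] OpMatrix q :=
  (diagOp q).comp (Algebra.lmul ℂ (SUq q))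

/-- The representation of the exterior algebra. -/
def rep (q : Set.Ioo (0 : ℝ) 1) : OmegaSU q →ₐ[ℂ] OpMatrix q :=
  liftOmega (funcOp q) (omegaOp q)
    (by
      intro a x
      -- `fmat_mul` read as an identity of operators: `f_{ab}` composed with multiplication by `x`.
      have h (b : Form) : diagOp q (fmat q a b) * funcOp q x
          = ∑ d, funcOp q (fmat q a d x) * diagOp q (fmat q d b) := by
        simp only [funcOp, AlgHom.comp_apply, ← map_mul, ← map_sum]
        congr 1
        ext y
        simp [fmat_mul]
      simp only [omegaOp, Finset.sum_mul, Finset.mul_sum, mul_assoc]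
      rw [Finset.sum_comm]
      refine Finset.sum_congr rfl fun b _ => ?_
      rw [funcOp, AlgHom.comp_apply, formOp_mul_diagOp, ← mul_assoc, ← AlgHom.comp_apply, ← funcOp,
        h, Finset.sum_mul]
      simp only [mul_assoc])
    (by
      intro k c hc
      rcases le_or_gt k 3 with hk | hk
      · exact wedge_of_quadratic (quadratic_omegaOp q) hk hc
      -- A word of more than three one-forms raises the degree beyond `3`, so these relations hold
      -- term by term.
      · refine Finset.sum_eq_zero fun v _ => ?_
        have := raises_list_prod (List.ofFn fun i => omegaOp q (v i))
          (by simp [List.mem_ofFn, raises_omegaOp])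
        rw [this.eq_zero (by rw [List.length_ofFn]; exact hk), smul_zero])

theorem rep_inc (x : SUq q) : rep q (inc q x) = funcOp q x := liftOmega_inc _ _ _ _ x

theorem rep_omega (a : Form) : rep q (omega q a) = omegaOp q a := liftOmega_omega _ _ _ _ a

/-- The coefficient function of a form in front of `ω_- ∧ ω_+ ∧ ω_0`. -/
def topPart (q : Set.Ioo (0 : ℝ) 1) : OmegaSU q →ₗ[ℂ] SUq q :=
  LinearMap.applyₗ 1 ∘ₗ Matrix.entryLinearMap ℂ (Module.End ℂ (SUq q)) top bot
    ∘ₗ (rep q).toLinearMap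

theorem topPart_inc_mul (f : SUq q) (θ : OmegaSU q) :
    topPart q (inc q f * θ) = f * topPart q θ := by
  simp [topPart, rep_inc, funcOp, diagOp_mul_apply]

/-- The volume form survives in the quotient. The correction terms in `ω_-` and `ω_+` carry a second
`ω_0` and drop out, leaving the operator `K²` as the relevant entry, and `K²` fixes `1`. -/
theorem topPart_volume (q : Set.Ioo (0 : ℝ) 1) :
    topPart q (omega q minus * omega q plus * omega q zero) = 1 := by
  have h := quadratic_formOp q
  have hcomm (a : Form) (X : Module.End ℂ (SUq q)) (A : OpMatrix q) :
      formOp q a * (diagOp q X * A) = diagOp q X * (formOp q a * A) := by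
    rw [← mul_assoc, formOp_mul_diagOp, mul_assoc]
  have op (x : OpMatrix q) : formOp q zero * (formOp q plus * x)
      = -(formOp q plus * (formOp q zero * x)) := by
    rw [← mul_assoc, h.op, Matrix.neg_mul, mul_assoc]
  have h1 : rep q (omega q minus * omega q plus * omega q zero)
      = diagOp q (fmat q zero zero) * (formOp q minus * (formOp q plus * formOp q zero)) := by
    have hid : diagOp q (LinearMap.id : Module.End ℂ (SUq q)) = 1 := map_one _
    simp [map_mul, rep_omega, omegaOp, Form.sum_eq, fmat, hid, add_mul, mul_assoc, hcomm, h.oo,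
      op]
  have h2 : (levelMul q minus * (levelMul q plus * levelMul q zero)) top bot = 1 := by
    rw [← mul_assoc, Matrix.mul_apply, Level.sum_eq]
    simp [levelMul_mul_top_one, levelMul, topCoeff]
  have h3 : formOp q minus * (formOp q plus * formOp q zero)
      = (Algebra.ofId ℂ (Module.End ℂ (SUq q))).mapMatrix
        (levelMul q minus * (levelMul q plus * levelMul q zero)) := by
    rw [map_mul, map_mul]
    rfl
  have h4 : (rep q (omega q minus * omega q plus * omega q zero)) top bot = fmat q zero zero := by
    rw [h1, diagOp_mul_apply, h3, AlgHom.mapMatrix_apply, Matrix.map_apply, h2, map_one, mul_one]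
  change (rep q (omega q minus * omega q plus * omega q zero)) top bot 1 = 1
  rw [h4]
  simp [fmat]

/-- The forms whose action raises degrees by `k`. -/
def raising (q : Set.Ioo (0 : ℝ) 1) (k : ℕ) : Submodule ℂ (OmegaSU q) where
  carrier := {θ | Raises k (rep q θ)}
  add_mem' hx hy n m h := by rw [map_add, Matrix.add_apply, hx n m h, hy n m h, add_zero]
  zero_mem' n m _ := by rw [map_zero, Matrix.zero_apply]
  smul_mem' t x hx n m h := by rw [map_smul, Matrix.smul_apply, hx n m h, smul_zero]

theorem mul_mem_raising {k l : ℕ} {x y : OmegaSU q} (hx : x ∈ raising q k)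
    (hy : y ∈ raising q l) : x * y ∈ raising q (k + l) := by
  change Raises (k + l) (rep q (x * y))
  rw [map_mul]
  exact Raises.mul hx hy

theorem inc_mem_raising (x : SUq q) : inc q x ∈ raising q 0 := by
  intro n m h
  rw [rep_inc]
  have : n ≠ m := by rintro rfl; exact h rfl
  simp [funcOp, diagOp, Matrix.scalar_apply, this]

theorem omega_mem_raising (a : Form) : omega q a ∈ raising q 1 := by
  change Raises 1 (rep q (omega q a))
  rw [rep_omega]
  exact raises_omegaOp a

/-- A common induction for degree statements, applied to both `raising` and `homogeneous`. -/
theorem formsSU_le {S : ℕ → Submodule ℂ (OmegaSU q)}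
    (hmul : ∀ {k l : ℕ} {x y : OmegaSU q}, x ∈ S k → y ∈ S l → x * y ∈ S (k + l))
    (hinc : ∀ x, inc q x ∈ S 0) (homega : ∀ a, omega q a ∈ S 1) (k : ℕ) : formsSU q k ≤ S k := by
  have h1 : Submodule.span ℂ (Set.range (omega q)) ^ k ≤ S k := by
    induction k with
    | zero =>
      rw [pow_zero, Submodule.one_le, ← map_one (inc q)]
      exact hinc 1
    | succ k ih =>
      rw [pow_succ, Submodule.mul_le]
      intro x hx y hy
      refine hmul (ih hx) ?_
      refine (Submodule.span_le.2 ?_ : _ ≤ S 1) hy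
      rintro _ ⟨a, rfl⟩
      exact homega a
  rw [formsSU, Submodule.mul_le]
  rintro _ ⟨x, rfl⟩ y hy
  simpa using hmul (hinc x) (h1 hy)

theorem topPart_of_mem_formsSU {k : ℕ} (hk : k < 3) {θ : OmegaSU q} (hθ : θ ∈ formsSU q k) :
    topPart q θ = 0 := by
  have h := formsSU_le mul_mem_raising inc_mem_raising omega_mem_raising k hθ top bot (by simp [Level.deg]; omega)
  change (rep q θ) top bot 1 = 0
  rw [h, LinearMap.zero_apply]

end QSphere

end

noncomputable section

namespace QSphere

variable {q : Set.Ioo (0 : ℝ) 1}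

open Form

/-! ## Relations in the exterior algebra -/

theorem omega_mul_inc (a : Form) (x : SUq q) :
    omega q a * inc q x = ∑ b, inc q (fmat q a b x) * omega q b := by
  have h := mkOmega_rel q (OmegaRel.bimodule a x)
  simp only [map_mul, map_sum] at h
  exact h

theorem wedge_relation {k : ℕ} {c : (Fin k → Form) → ℂ} (hc : antisym q k c = 0) :
    ∑ v : Fin k → Form, c v • (List.ofFn fun i => omega q (v i)).prod = 0 := by
  have h := mkOmega_rel q (OmegaRel.wedge k c hc)
  simp only [map_sum, map_smul, map_list_prod, List.map_ofFn, map_zero] at h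
  exact h

theorem wedge_relation_two {T : Matrix Form Form ℂ}
    (hT : ∀ n k, T n k = ∑ a, ∑ b, sigma q a b n k * T a b) :
    ∑ a, ∑ b, T a b • (omega q a * omega q b) = 0 := by
  have h := wedge_relation (q := q) (k := 2) (c := fun v => T (v 0) (v 1))
    ((antisym_two_eq_zero_iff _).2 fun n k => by simpa using hT n k)
  rw [sum_words_two] at h
  simpa using h

theorem omega_sq {a : Form} (ha : a ≠ z) : omega q a * omega q a = 0 := by
  have h := wedge_relation_two (q := q) (T := ten a a) fun n k => by
    cases a <;> first | exact absurd rfl ha | (cases n <;> cases k <;>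
      simp [Form.sum_eq, sigma, ten])
  cases a <;> first | exact absurd rfl ha | simpa [Form.sum_eq, ten] using h

theorem omega_plus_minus : omega q plus * omega q minus = -(omega q minus * omega q plus) := by
  have h := wedge_relation_two (q := q) (T := ten plus minus + ten minus plus) fun n k => by
    cases n <;> cases k <;> simp [Form.sum_eq, sigma, ten]
  simp [Form.sum_eq, ten] at h
  exact eq_neg_of_add_eq_zero_right h

theorem omega_zero_minus : omega q zero * omega q minus = -(omega q minus * omega q zero) := by
  have h := wedge_relation_two (q := q) (T := ten zero minus + ten minus zero) fun n k => by
    cases n <;> cases k <;> simp [Form.sum_eq, sigma, ten]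
  simp [Form.sum_eq, ten] at h
  exact eq_neg_of_add_eq_zero_right h

theorem omega_zero_plus : omega q zero * omega q plus = -(omega q plus * omega q zero) := by
  have h := wedge_relation_two (q := q) (T := ten zero plus + ten plus zero) fun n k => by
    cases n <;> cases k <;> simp [Form.sum_eq, sigma, ten]
  simp [Form.sum_eq, ten] at h
  exact eq_neg_of_add_eq_zero_right h

/-! ## The grading -/

open Polynomial in
/-- The algebra map sending `ω_{a_1} ∧ ⋯ ∧ ω_{a_k}` to its product with `X ^ k`. -/
def gradeHom (q : Set.Ioo (0 : ℝ) 1) : OmegaSU q →ₐ[ℂ] (OmegaSU q)[X] :=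
  liftOmega (CAlgHom.comp (inc q)) (fun a => monomial 1 (omega q a))
    (by
      intro a x
      simp only [AlgHom.comp_apply, CAlgHom_apply, monomial_mul_C, C_mul_monomial]
      rw [omega_mul_inc, map_sum])
    (by
      intro k c hc
      have h (l : List (OmegaSU q)) :
          (l.map fun u => (monomial 1 u : (OmegaSU q)[X])).prod = monomial l.length l.prod := by
        induction l with
        | nil => simp
        | cons u l ih => rw [List.map_cons, List.prod_cons, ih, monomial_mul_monomial,
            List.length_cons, List.prod_cons, add_comm]
      have h1 (v : Fin k → Form) : (List.ofFn fun i => (monomial 1 (omega q (v i)) :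
          (OmegaSU q)[X])).prod = monomial k (List.ofFn fun i => omega q (v i)).prod := by
        have := h (List.ofFn fun i => omega q (v i))
        rwa [List.map_ofFn, List.length_ofFn] at this
      simp only [h1, smul_monomial]
      rw [← map_sum, wedge_relation hc, map_zero])

/-- The homogeneous forms of degree `k`. -/
def homogeneous (q : Set.Ioo (0 : ℝ) 1) (k : ℕ) : Submodule ℂ (OmegaSU q) where
  carrier := {θ | gradeHom q θ = Polynomial.monomial k θ}
  add_mem' {x y} hx hy := by
    change gradeHom q (x + y) = _
    rw [map_add, show gradeHom q x = _ from hx, show gradeHom q y = _ from hy, map_add]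
  zero_mem' := by simp
  smul_mem' t x hx := by
    change gradeHom q (t • x) = _
    rw [map_smul, show gradeHom q x = _ from hx, Polynomial.smul_monomial]

theorem mul_mem_homogeneous {k l : ℕ} {x y : OmegaSU q} (hx : x ∈ homogeneous q k)
    (hy : y ∈ homogeneous q l) : x * y ∈ homogeneous q (k + l) := by
  change gradeHom q (x * y) = _
  rw [map_mul, show gradeHom q x = _ from hx, show gradeHom q y = _ from hy,
    Polynomial.monomial_mul_monomial]

theorem formsSU_le_homogeneous (k : ℕ) : formsSU q k ≤ homogeneous q k := by
  apply formsSU_le mul_mem_homogeneous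
  · intro x
    exact liftOmega_inc _ _ _ _ x
  · intro a
    exact liftOmega_omega _ _ _ _ a

/-- Compare the coefficients of `X^k` after `gradeHom`. This replaces a direct sum decomposition of
the quotient algebra. -/
theorem eq_of_homogeneous_sum {θ : ℕ → OmegaSU q} {n k : ℕ} (hk : k < n)
    (h : ∀ i < n, θ i ∈ homogeneous q i)
    (hsum : ∑ i ∈ Finset.range n, θ i ∈ homogeneous q k) :
    ∑ i ∈ Finset.range n, θ i = θ k := by
  have h1 : gradeHom q (∑ i ∈ Finset.range n, θ i)
      = Polynomial.monomial k (∑ i ∈ Finset.range n, θ i) := hsum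
  have h2 := congrArg (fun p => Polynomial.coeff p k) h1
  simp only [map_sum (gradeHom q), Polynomial.finsetSum_coeff, Polynomial.coeff_monomial_same] at h2
  rw [← h2, Finset.sum_eq_single_of_mem k (Finset.mem_range.2 hk)]
  · rw [show gradeHom q (θ k) = _ from h k hk, Polynomial.coeff_monomial_same]
  · intro i hi hik
    rw [show gradeHom q (θ i) = _ from h i (Finset.mem_range.1 hi), Polynomial.coeff_monomial_of_ne _ hik.symm]

theorem inc_mem_formsSU (x : SUq q) : inc q x ∈ formsSU q 0 := by
  rw [formsSU, pow_zero, mul_one]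
  exact ⟨x, rfl⟩

theorem mul_omega_mem_formsSU {k : ℕ} {θ : OmegaSU q} (h : θ ∈ formsSU q k) (a : Form) :
    θ * omega q a ∈ formsSU q (k + 1) := by
  rw [formsSU, pow_succ, ← mul_assoc]
  exact Submodule.mul_mem_mul h (Submodule.subset_span ⟨a, rfl⟩)

/-! ## Forms without `ω_z` -/

/-- The form with the given coefficients. -/
def formOf (x₀ x₁ x₂ x₃ y₁ y₂ y₃ t : SUq q) : OmegaSU q :=
  inc q x₀ + (inc q x₁ * omega q minus + inc q x₂ * omega q plus + inc q x₃ * omega q zero)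
    + (inc q y₁ * omega q minus * omega q plus + inc q y₂ * omega q minus * omega q zero
      + inc q y₃ * omega q plus * omega q zero)
    + inc q t * omega q minus * omega q plus * omega q zero

theorem inc_mul_formOf (x x₀ x₁ x₂ x₃ y₁ y₂ y₃ t : SUq q) :
    inc q x * formOf x₀ x₁ x₂ x₃ y₁ y₂ y₃ t =
      formOf (x * x₀) (x * x₁) (x * x₂) (x * x₃) (x * y₁) (x * y₂) (x * y₃) (x * t) := by
  simp only [formOf, mul_add, map_mul, mul_assoc]

theorem formOf_add (x₀ x₁ x₂ x₃ y₁ y₂ y₃ t x₀' x₁' x₂' x₃' y₁' y₂' y₃' t' : SUq q) :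
    formOf x₀ x₁ x₂ x₃ y₁ y₂ y₃ t + formOf x₀' x₁' x₂' x₃' y₁' y₂' y₃' t' =
      formOf (x₀ + x₀') (x₁ + x₁') (x₂ + x₂') (x₃ + x₃') (y₁ + y₁') (y₂ + y₂') (y₃ + y₃')
        (t + t') := by
  simp only [formOf, map_add, add_mul]
  abel

theorem smul_formOf (r : ℂ) (x₀ x₁ x₂ x₃ y₁ y₂ y₃ t : SUq q) :
    r • formOf x₀ x₁ x₂ x₃ y₁ y₂ y₃ t =
      formOf (r • x₀) (r • x₁) (r • x₂) (r • x₃) (r • y₁) (r • y₂) (r • y₃) (r • t) := by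
  simp only [formOf, map_smul, smul_add, smul_mul_assoc]

/-- The rows of `fmat` for `-`, `+` and `0` have no entry in the column `z`, and the three forms
anticommute; so left multiplication by any of them stays within forms without `ω_z`. -/
theorem omega_minus_mul_formOf (x₀ x₁ x₂ x₃ y₁ y₂ y₃ t : SUq q) :
    omega q minus * formOf x₀ x₁ x₂ x₃ y₁ y₂ y₃ t =
      formOf 0 x₀ 0 (fmat q minus zero x₀) x₂ (x₃ - fmat q minus zero x₁)
        (-fmat q minus zero x₂) (fmat q minus zero y₁ + y₃) := by
  have hb (x : SUq q) (v : OmegaSU q) : omega q minus * (inc q x * v) = inc q x * (omega q minus * v)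
      + inc q (fmat q minus zero x) * (omega q zero * v) := by
    rw [← mul_assoc, omega_mul_inc]
    simp [Form.sum_eq, fmat, add_mul, mul_assoc]
  have hb' (x : SUq q) := hb x 1
  simp only [mul_one] at hb'
  have mm (x : OmegaSU q) : omega q minus * (omega q minus * x) = 0 := by
    rw [← mul_assoc, omega_sq (by simp), zero_mul]
  have om (x : OmegaSU q) : omega q zero * (omega q minus * x)
      = -(omega q minus * (omega q zero * x)) := by
    rw [← mul_assoc, omega_zero_minus, neg_mul, mul_assoc]
  have op (x : OmegaSU q) : omega q zero * (omega q plus * x)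
      = -(omega q plus * (omega q zero * x)) := by
    rw [← mul_assoc, omega_zero_plus, neg_mul, mul_assoc]
  have oo : omega q zero * omega q zero = 0 := omega_sq (by simp)
  have mm' : omega q minus * omega q minus = 0 := omega_sq (by simp)
  simp only [formOf, mul_add, mul_assoc, hb, hb', mm, om, op, oo, mm', omega_zero_minus,
    omega_zero_plus, map_zero, map_sub, map_neg, map_add, zero_mul, mul_zero, neg_zero, mul_neg,
    neg_mul, sub_mul, add_mul, neg_neg]
  abel

theorem omega_plus_mul_formOf (x₀ x₁ x₂ x₃ y₁ y₂ y₃ t : SUq q) :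
    omega q plus * formOf x₀ x₁ x₂ x₃ y₁ y₂ y₃ t =
      formOf 0 0 x₀ (fmat q plus zero x₀) (-x₁) (-fmat q plus zero x₁)
        (x₃ - fmat q plus zero x₂) (fmat q plus zero y₁ - y₂) := by
  have hb (x : SUq q) (v : OmegaSU q) : omega q plus * (inc q x * v) = inc q x * (omega q plus * v)
      + inc q (fmat q plus zero x) * (omega q zero * v) := by
    rw [← mul_assoc, omega_mul_inc]
    simp [Form.sum_eq, fmat, add_mul, mul_assoc]
  have hb' (x : SUq q) := hb x 1
  simp only [mul_one] at hb'
  have pp (x : OmegaSU q) : omega q plus * (omega q plus * x) = 0 := by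
    rw [← mul_assoc, omega_sq (by simp), zero_mul]
  have pm (x : OmegaSU q) : omega q plus * (omega q minus * x)
      = -(omega q minus * (omega q plus * x)) := by
    rw [← mul_assoc, omega_plus_minus, neg_mul, mul_assoc]
  have om (x : OmegaSU q) : omega q zero * (omega q minus * x)
      = -(omega q minus * (omega q zero * x)) := by
    rw [← mul_assoc, omega_zero_minus, neg_mul, mul_assoc]
  have op (x : OmegaSU q) : omega q zero * (omega q plus * x)
      = -(omega q plus * (omega q zero * x)) := by
    rw [← mul_assoc, omega_zero_plus, neg_mul, mul_assoc]
  have oo : omega q zero * omega q zero = 0 := omega_sq (by simp)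
  have pp' : omega q plus * omega q plus = 0 := omega_sq (by simp)
  simp only [formOf, mul_add, mul_assoc, hb, hb', pp, pm, om, op, oo, pp', omega_plus_minus,
    omega_zero_minus, omega_zero_plus, map_zero, map_sub, map_neg, zero_mul, mul_zero,
    neg_zero, mul_neg, neg_mul, sub_mul, neg_neg]
  abel

theorem omega_zero_mul_formOf (x₀ x₁ x₂ x₃ y₁ y₂ y₃ t : SUq q) :
    omega q zero * formOf x₀ x₁ x₂ x₃ y₁ y₂ y₃ t =
      formOf 0 0 0 (fmat q zero zero x₀) 0 (-fmat q zero zero x₁) (-fmat q zero zero x₂)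
        (fmat q zero zero y₁) := by
  have hb (x : SUq q) (v : OmegaSU q) : omega q zero * (inc q x * v)
      = inc q (fmat q zero zero x) * (omega q zero * v) := by
    rw [← mul_assoc, omega_mul_inc]
    simp [Form.sum_eq, fmat, mul_assoc]
  have hb' (x : SUq q) := hb x 1
  simp only [mul_one] at hb'
  have om (x : OmegaSU q) : omega q zero * (omega q minus * x)
      = -(omega q minus * (omega q zero * x)) := by
    rw [← mul_assoc, omega_zero_minus, neg_mul, mul_assoc]
  have op (x : OmegaSU q) : omega q zero * (omega q plus * x)
      = -(omega q plus * (omega q zero * x)) := by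
    rw [← mul_assoc, omega_zero_plus, neg_mul, mul_assoc]
  have oo : omega q zero * omega q zero = 0 := omega_sq (by simp)
  simp only [formOf, mul_add, mul_assoc, hb, hb', om, op, oo, omega_zero_minus, omega_zero_plus,
    map_zero, map_neg, zero_mul, mul_zero, neg_zero, mul_neg, neg_mul, neg_neg]
  abel

theorem topPart_formOf (x₀ x₁ x₂ x₃ y₁ y₂ y₃ t : SUq q) :
    topPart q (formOf x₀ x₁ x₂ x₃ y₁ y₂ y₃ t) = t := by
  have h0 : ∀ x : SUq q, topPart q (inc q x) = 0 := fun x =>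
    topPart_of_mem_formsSU (by norm_num) (inc_mem_formsSU x)
  have h1 : ∀ (x : SUq q) (a : Form), topPart q (inc q x * omega q a) = 0 := fun x a =>
    topPart_of_mem_formsSU (by norm_num) (mul_omega_mem_formsSU (inc_mem_formsSU x) a)
  have h2 : ∀ (x : SUq q) (a b : Form), topPart q (inc q x * omega q a * omega q b) = 0 :=
    fun x a b => topPart_of_mem_formsSU (by norm_num)
      (mul_omega_mem_formsSU (mul_omega_mem_formsSU (inc_mem_formsSU x) a) b)
  have h3 : topPart q (inc q t * omega q minus * omega q plus * omega q zero) = t := by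
    rw [mul_assoc, mul_assoc, topPart_inc_mul, ← mul_assoc, topPart_volume, mul_one]
  simp only [formOf, map_add, h0, h1, h2, h3, zero_add, add_zero]

end QSphere

end

noncomputable section

namespace QSphere

variable {q : Set.Ioo (0 : ℝ) 1}

open Form

/-! ## The exterior algebra of the sphere -/

theorem fmat_minus_zero_mem {n k : ℤ} {x : SUq q} (hx : x ∈ weight q n) (hk : n + 1 = k) :
    fmat q minus zero x ∈ weight q k := by
  have h := actE_mem_weight hx hk
  change (qh q)⁻¹ • actK q (actE q x) ∈ _
  rw [mem_weight.1 h]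
  exact Submodule.smul_mem _ _ (Submodule.smul_mem _ _ h)

theorem fmat_plus_zero_mem {n k : ℤ} {x : SUq q} (hx : x ∈ weight q n) (hk : n - 1 = k) :
    fmat q plus zero x ∈ weight q k := by
  change (qh q)⁻¹ • actF q (actK q x) ∈ _
  rw [mem_weight.1 hx, map_smul]
  exact Submodule.smul_mem _ _ (Submodule.smul_mem _ _ (actF_mem_weight hx hk))

theorem fmat_zero_zero_apply {n : ℤ} {x : SUq q} (hx : x ∈ weight q n) :
    fmat q zero zero x = (qc q ^ n * qc q ^ n) • x := by
  change actK q (actK q x) = _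
  rw [mem_weight.1 hx, map_smul, mem_weight.1 hx, smul_smul]

theorem fmat_zero_zero_mem {n : ℤ} {x : SUq q} (hx : x ∈ weight q n) :
    fmat q zero zero x ∈ weight q n := by
  rw [fmat_zero_zero_apply hx]
  exact Submodule.smul_mem _ _ hx

/-- The forms without `ω_z` whose coefficients have the weights that make them invariant. -/
def sphereForms (q : Set.Ioo (0 : ℝ) 1) : Submodule ℂ (OmegaSU q) where
  carrier := {θ | ∃ x₀ ∈ weight q 0, ∃ x₁ ∈ weight q (-1), ∃ x₂ ∈ weight q 1,
    ∃ x₃ ∈ weight q 0, ∃ y₁ ∈ weight q 0, ∃ y₂ ∈ weight q (-1), ∃ y₃ ∈ weight q 1,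
    ∃ t ∈ weight q 0, θ = formOf x₀ x₁ x₂ x₃ y₁ y₂ y₃ t}
  add_mem' := by
    rintro _ _ ⟨x₀, h0, x₁, h1, x₂, h2, x₃, h3, y₁, h4, y₂, h5, y₃, h6, t, h7, rfl⟩
      ⟨x₀', h0', x₁', h1', x₂', h2', x₃', h3', y₁', h4', y₂', h5', y₃', h6', t', h7', rfl⟩
    exact ⟨_, add_mem h0 h0', _, add_mem h1 h1', _, add_mem h2 h2', _, add_mem h3 h3',
      _, add_mem h4 h4', _, add_mem h5 h5', _, add_mem h6 h6', _, add_mem h7 h7', formOf_add ..⟩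
  zero_mem' := ⟨0, zero_mem _, 0, zero_mem _, 0, zero_mem _, 0, zero_mem _, 0, zero_mem _,
    0, zero_mem _, 0, zero_mem _, 0, zero_mem _, by simp [formOf]⟩
  smul_mem' := by
    rintro r _ ⟨x₀, h0, x₁, h1, x₂, h2, x₃, h3, y₁, h4, y₂, h5, y₃, h6, t, h7, rfl⟩
    exact ⟨_, Submodule.smul_mem _ r h0, _, Submodule.smul_mem _ r h1,
      _, Submodule.smul_mem _ r h2, _, Submodule.smul_mem _ r h3, _, Submodule.smul_mem _ r h4,
      _, Submodule.smul_mem _ r h5, _, Submodule.smul_mem _ r h6, _, Submodule.smul_mem _ r h7,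
      smul_formOf ..⟩

theorem inc_mul_mem_sphereForms {x : SUq q} (hx : x ∈ weight q 0) {θ : OmegaSU q}
    (hθ : θ ∈ sphereForms q) : inc q x * θ ∈ sphereForms q := by
  obtain ⟨x₀, h0, x₁, h1, x₂, h2, x₃, h3, y₁, h4, y₂, h5, y₃, h6, t, h7, rfl⟩ := hθ
  exact ⟨_, mul_mem_weight hx h0 rfl, _, mul_mem_weight hx h1 rfl, _, mul_mem_weight hx h2 rfl,
    _, mul_mem_weight hx h3 rfl, _, mul_mem_weight hx h4 rfl, _, mul_mem_weight hx h5 rfl,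
    _, mul_mem_weight hx h6 rfl, _, mul_mem_weight hx h7 rfl, inc_mul_formOf ..⟩

theorem minus_mul_mem_sphereForms {x : SUq q} (hx : x ∈ weight q (-1)) {θ : OmegaSU q}
    (hθ : θ ∈ sphereForms q) : inc q x * omega q minus * θ ∈ sphereForms q := by
  obtain ⟨x₀, h0, x₁, h1, x₂, h2, x₃, h3, y₁, h4, y₂, h5, y₃, h6, t, h7, rfl⟩ := hθ
  rw [mul_assoc, omega_minus_mul_formOf, inc_mul_formOf]
  refine ⟨_, ?_, _, mul_mem_weight hx h0 rfl, _, ?_,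
    _, mul_mem_weight hx (fmat_minus_zero_mem h0 rfl) rfl,
    _, mul_mem_weight hx h2 rfl,
    _, mul_mem_weight hx (sub_mem h3 (fmat_minus_zero_mem h1 rfl)) rfl,
    _, mul_mem_weight hx (neg_mem (fmat_minus_zero_mem h2 rfl)) rfl,
    _, mul_mem_weight hx (add_mem (fmat_minus_zero_mem h4 rfl) h6) rfl, rfl⟩
  all_goals
    rw [mul_zero]
    exact zero_mem _

theorem plus_mul_mem_sphereForms {x : SUq q} (hx : x ∈ weight q 1) {θ : OmegaSU q}
    (hθ : θ ∈ sphereForms q) : inc q x * omega q plus * θ ∈ sphereForms q := by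
  obtain ⟨x₀, h0, x₁, h1, x₂, h2, x₃, h3, y₁, h4, y₂, h5, y₃, h6, t, h7, rfl⟩ := hθ
  rw [mul_assoc, omega_plus_mul_formOf, inc_mul_formOf]
  refine ⟨_, ?_, _, ?_, _, mul_mem_weight hx h0 rfl,
    _, mul_mem_weight hx (fmat_plus_zero_mem h0 rfl) rfl,
    _, mul_mem_weight hx (neg_mem h1) rfl,
    _, mul_mem_weight hx (neg_mem (fmat_plus_zero_mem h1 rfl)) rfl,
    _, mul_mem_weight hx (sub_mem h3 (fmat_plus_zero_mem h2 rfl)) rfl,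
    _, mul_mem_weight hx (sub_mem (fmat_plus_zero_mem h4 rfl) h5) rfl, rfl⟩
  all_goals
    rw [mul_zero]
    exact zero_mem _

theorem zero_mul_mem_sphereForms {x : SUq q} (hx : x ∈ weight q 0) {θ : OmegaSU q}
    (hθ : θ ∈ sphereForms q) : inc q x * omega q zero * θ ∈ sphereForms q := by
  obtain ⟨x₀, h0, x₁, h1, x₂, h2, x₃, h3, y₁, h4, y₂, h5, y₃, h6, t, h7, rfl⟩ := hθ
  rw [mul_assoc, omega_zero_mul_formOf, inc_mul_formOf]
  refine ⟨_, ?_, _, ?_, _, ?_, _, mul_mem_weight hx (fmat_zero_zero_mem h0) rfl,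
    _, ?_, _, mul_mem_weight hx (neg_mem (fmat_zero_zero_mem h1)) rfl,
    _, mul_mem_weight hx (neg_mem (fmat_zero_zero_mem h2)) rfl,
    _, mul_mem_weight hx (fmat_zero_zero_mem h4) rfl, rfl⟩
  all_goals
    rw [mul_zero]
    exact zero_mem _

/-- On weight zero `K` acts trivially, so `L_z` vanishes and only `FE` remains of `L_0`. -/
theorem diff_apply_of_mem_sphere {f : SUq q} (hf : f ∈ weight q 0) :
    diff q f = inc q (qh q • actF q f) * omega q minus
      + inc q ((qh q)⁻¹ • actE q f) * omega q plus
      + inc q (actF q (actE q f)) * omega q zero := by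
  have h1 : actK q f = f := by simpa using mem_weight.1 hf
  have h2 : actKi q f = f := by simpa using actKi_of_mem_weight hf
  simp [diff, Form.sum_eq, tangent, h1, h2]

theorem OmegaS_le_sphereForms : Subalgebra.toSubmodule (OmegaS q) ≤ sphereForms q := by
  -- The left multipliers of `sphereForms` form a subalgebra by construction. It is enough that it
  -- contains the generators, since `1` belongs to `sphereForms`.
  let T : Subalgebra ℂ (OmegaSU q) :=
    { carrier := {θ | ∀ η ∈ sphereForms q, θ * η ∈ sphereForms q}
      mul_mem' := fun hx hy η hη => by rw [mul_assoc]; exact hx _ (hy _ hη)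
      add_mem' := fun hx hy η hη => by rw [add_mul]; exact add_mem (hx _ hη) (hy _ hη)
      algebraMap_mem' := fun r η hη => by
        rw [← Algebra.smul_def]
        exact Submodule.smul_mem _ _ hη }
  have hT : OmegaS q ≤ T := by
    rw [OmegaS, Algebra.adjoin_le_iff]
    rintro _ (⟨f, hf, rfl⟩ | ⟨f, hf, rfl⟩)
    · exact fun η hη => inc_mul_mem_sphereForms (mem_sphere.1 hf) hη
    · have hf' := mem_sphere.1 hf
      intro η hη
      rw [diff_apply_of_mem_sphere hf', add_mul, add_mul]
      refine add_mem (add_mem (minus_mul_mem_sphereForms ?_ hη) (plus_mul_mem_sphereForms ?_ hη))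
        (zero_mul_mem_sphereForms ?_ hη)
      · exact Submodule.smul_mem _ _ (actF_mem_weight hf' rfl)
      · exact Submodule.smul_mem _ _ (actE_mem_weight hf' rfl)
      · exact actF_mem_weight (actE_mem_weight hf' rfl) rfl
  intro θ hθ
  have h1 : (1 : SUq q) ∈ weight q 0 := by simp [mem_weight]
  have h := hT hθ 1 ⟨1, h1, 0, zero_mem _, 0, zero_mem _, 0, zero_mem _, 0, zero_mem _,
    0, zero_mem _, 0, zero_mem _, 0, zero_mem _, by simp [formOf]⟩
  rwa [mul_one] at h

theorem inc_mem_OmegaS {f : SUq q} (hf : f ∈ weight q 0) : inc q f ∈ OmegaS q :=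
  Algebra.subset_adjoin (Or.inl ⟨f, mem_sphere.2 hf, rfl⟩)

theorem diff_mem_OmegaS {f : SUq q} (hf : f ∈ weight q 0) : diff q f ∈ OmegaS q :=
  Algebra.subset_adjoin (Or.inr ⟨f, mem_sphere.2 hf, rfl⟩)

end QSphere

end

noncomputable section

namespace QSphere

variable {q : Set.Ioo (0 : ℝ) 1}

open Form

/-! ### Sphere forms from the spin one coordinates -/

theorem c_cs_mem : gen q .c * gen q .cs ∈ weight q 0 := by
  have h0 := qh_ne_zero q
  simp [mem_weight, actK_gen, scaleGen, smul_smul, h0]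

theorem a_cs_mem : gen q .a * gen q .cs ∈ weight q 0 := by
  have h0 := qh_ne_zero q
  simp [mem_weight, actK_gen, scaleGen, smul_smul, h0]

theorem c_as_mem : gen q .c * gen q .as ∈ weight q 0 := by
  have h0 := qh_ne_zero q
  simp [mem_weight, actK_gen, scaleGen, smul_smul, h0]

theorem mul_mem_weight_neg_one {g g' : Gen} (hg : g = .a ∨ g = .c) (hg' : g' = .a ∨ g' = .c) :
    gen q g * gen q g' ∈ weight q (-1) := by
  rw [mem_weight, zpow_neg_one, ← qh_sq, mul_inv]
  rcases hg with rfl | rfl <;> rcases hg' with rfl | rfl <;>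
    simp [actK_gen, scaleGen, smul_smul]

theorem mul_mem_weight_one {g g' : Gen} (hg : g = .as ∨ g = .cs) (hg' : g' = .as ∨ g' = .cs) :
    gen q g * gen q g' ∈ weight q 1 := by
  rw [mem_weight, zpow_one, ← qh_sq]
  rcases hg with rfl | rfl <;> rcases hg' with rfl | rfl <;>
    simp [actK_gen, scaleGen, smul_smul]

theorem c_mul_a : gen q .c * gen q .a = (qc q)⁻¹ • (gen q .a * gen q .c) := by
  simpa using c_mul_a_pow (q := q) 1

theorem cs_mul_a : gen q .cs * gen q .a = (qc q)⁻¹ • (gen q .a * gen q .cs) := by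
  simpa using cs_mul_a_pow (q := q) 1

theorem as_mul_a : gen q .as * gen q .a = 1 - gen q .c * gen q .cs := by
  rw [eq_sub_iff_add_eq, (gen_respects q).c_cs, (gen_respects q).as_a]

theorem a_mul_as : gen q .a * gen q .as = 1 - qc q ^ 2 • (gen q .c * gen q .cs) := by
  rw [eq_sub_iff_add_eq, (gen_respects q).a_as]

theorem c_mul_a_mul (x : SUq q) :
    gen q .c * (gen q .a * x) = (qc q)⁻¹ • (gen q .a * (gen q .c * x)) := by
  rw [← mul_assoc, c_mul_a, smul_mul_assoc, mul_assoc]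

theorem cs_mul_a_mul (x : SUq q) :
    gen q .cs * (gen q .a * x) = (qc q)⁻¹ • (gen q .a * (gen q .cs * x)) := by
  rw [← mul_assoc, cs_mul_a, smul_mul_assoc, mul_assoc]

theorem c_mul_as_mul (x : SUq q) :
    gen q .c * (gen q .as * x) = qc q • (gen q .as * (gen q .c * x)) := by
  rw [← mul_assoc, (gen_respects q).c_as, smul_mul_assoc, mul_assoc]

theorem cs_mul_as_mul (x : SUq q) :
    gen q .cs * (gen q .as * x) = qc q • (gen q .as * (gen q .cs * x)) := by
  rw [← mul_assoc, (gen_respects q).cs_as, smul_mul_assoc, mul_assoc]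

theorem cs_mul_c_mul (x : SUq q) :
    gen q .cs * (gen q .c * x) = gen q .c * (gen q .cs * x) := by
  rw [← mul_assoc, ← (gen_respects q).c_cs, mul_assoc]

theorem as_mul_a_mul (x : SUq q) :
    gen q .as * (gen q .a * x) = x - gen q .c * (gen q .cs * x) := by
  rw [← mul_assoc, as_mul_a, sub_mul, one_mul, mul_assoc]

theorem a_mul_as_mul (x : SUq q) :
    gen q .a * (gen q .as * x) = x - qc q ^ 2 • (gen q .c * (gen q .cs * x)) := by
  rw [← mul_assoc, a_mul_as, sub_mul, one_mul, smul_mul_assoc, mul_assoc]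

theorem diff_c_cs : diff q (gen q .c * gen q .cs) =
    inc q (-(gen q .c * gen q .a)) * omega q minus
      + inc q (gen q .as * gen q .cs) * omega q plus
      + inc q ((qc q + (qc q)⁻¹) • (gen q .c * gen q .cs) - algebraMap ℂ _ (qc q)⁻¹)
        * omega q zero := by
  have h0 := qh_ne_zero q
  have h1 := qc_ne_zero q
  rw [diff_apply_of_mem_sphere c_cs_mem]
  congr 1
  · congr 3 <;> simp [actF_mul, actE_mul, actF_gen, actE_gen, actK_gen, actKi_gen, genE, genF,
      scaleGen, smul_smul, h0]
    rw [mul_left_comm, qh_sq, inv_mul_cancel₀ h1, one_smul]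
  · congr 2
    simp [actF_mul, actE_mul, actF_gen, actE_gen, actK_gen, actKi_gen, genE, genF, scaleGen,
      smul_smul, as_mul_a, Algebra.algebraMap_eq_smul_one, smul_sub]
    match_scalars <;> simp only [← qh_sq] <;> field_simp

theorem diff_a_cs : diff q (gen q .a * gen q .cs) =
    inc q (-(gen q .a * gen q .a)) * omega q minus
      + inc q (-(qc q • (gen q .cs * gen q .cs))) * omega q plus
      + inc q ((qc q + (qc q)⁻¹) • (gen q .a * gen q .cs)) * omega q zero := by
  have h0 := qh_ne_zero q
  have h1 := qc_ne_zero q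
  rw [diff_apply_of_mem_sphere a_cs_mem]
  congr 1
  · congr 3 <;> simp [actF_mul, actE_mul, actF_gen, actE_gen, actK_gen, actKi_gen, genE, genF,
      scaleGen, smul_smul, h0]
    rw [mul_left_comm, qh_sq, inv_mul_cancel₀ h1, one_smul]
  · congr 2
    simp [actF_mul, actE_mul, actF_gen, actE_gen, actK_gen, actKi_gen, genE, genF, scaleGen,
      smul_smul, cs_mul_a]
    match_scalars
    simp only [← qh_sq]
    field_simp
    ring

theorem diff_c_as : diff q (gen q .c * gen q .as) =
    inc q (qc q • (gen q .c * gen q .c)) * omega q minus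
      + inc q (gen q .as * gen q .as) * omega q plus
      + inc q ((qc q + (qc q)⁻¹) • (gen q .c * gen q .as)) * omega q zero := by
  have h0 := qh_ne_zero q
  have h1 := qc_ne_zero q
  rw [diff_apply_of_mem_sphere c_as_mem]
  congr 1
  · congr 3 <;> simp [actF_mul, actE_mul, actF_gen, actE_gen, actK_gen, actKi_gen, genE, genF,
      scaleGen, smul_smul, h0, qh_sq]
  · congr 2
    simp [actF_mul, actE_mul, actF_gen, actE_gen, actK_gen, actKi_gen, genE, genF, scaleGen,
      smul_smul, (gen_respects q).c_as]
    match_scalars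
    simp only [← qh_sq]
    field_simp

/-- A form `u₁ d(c c^*) + u₂ d(a c^*) + u₃ d(c a^*)`. -/
theorem sum_mul_diff (u₁ u₂ u₃ : SUq q) :
    inc q u₁ * diff q (gen q .c * gen q .cs) + inc q u₂ * diff q (gen q .a * gen q .cs)
      + inc q u₃ * diff q (gen q .c * gen q .as) =
    inc q (u₁ * -(gen q .c * gen q .a) + u₂ * -(gen q .a * gen q .a)
        + u₃ * (qc q • (gen q .c * gen q .c))) * omega q minus
      + inc q (u₁ * (gen q .as * gen q .cs) + u₂ * -(qc q • (gen q .cs * gen q .cs))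
        + u₃ * (gen q .as * gen q .as)) * omega q plus
      + inc q (u₁ * ((qc q + (qc q)⁻¹) • (gen q .c * gen q .cs) - algebraMap ℂ _ (qc q)⁻¹)
        + u₂ * ((qc q + (qc q)⁻¹) • (gen q .a * gen q .cs))
        + u₃ * ((qc q + (qc q)⁻¹) • (gen q .c * gen q .as))) * omega q zero := by
  rw [diff_c_cs, diff_a_cs, diff_c_as]
  simp only [map_add, map_mul, mul_add, add_mul, mul_assoc]
  abel

theorem sum_mul_diff_mem {x u₁ u₂ u₃ : SUq q} {n : ℤ} (hx : x ∈ weight q (-n))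
    (h₁ : u₁ ∈ weight q n) (h₂ : u₂ ∈ weight q n) (h₃ : u₃ ∈ weight q n) :
    inc q (x * u₁) * diff q (gen q .c * gen q .cs) + inc q (x * u₂) * diff q (gen q .a * gen q .cs)
      + inc q (x * u₃) * diff q (gen q .c * gen q .as) ∈ OmegaS q := by
  have h {u f : SUq q} (hu : u ∈ weight q n) (hf : f ∈ weight q 0) :
      inc q (x * u) * diff q f ∈ OmegaS q :=
    mul_mem (inc_mem_OmegaS (mul_mem_weight hx hu (by ring))) (diff_mem_OmegaS hf)
  exact add_mem (add_mem (h h₁ c_cs_mem) (h h₂ a_cs_mem)) (h h₃ c_as_mem)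

/-- The `u_i` need not be functions on the sphere: only the products `x u_i` must have weight zero.
One may thus solve for `ω_-` or `ω_+` itself over `SUq q` and multiply by `x` afterwards. -/
theorem mem_OmegaS_of_sum_mul_diff {x u₁ u₂ u₃ r₁ r₂ r₃ : SUq q} {n : ℤ}
    (hx : x ∈ weight q (-n))
    (h₁ : u₁ ∈ weight q n) (h₂ : u₂ ∈ weight q n) (h₃ : u₃ ∈ weight q n)
    (hr₁ : u₁ * -(gen q .c * gen q .a) + u₂ * -(gen q .a * gen q .a)
      + u₃ * (qc q • (gen q .c * gen q .c)) = r₁)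
    (hr₂ : u₁ * (gen q .as * gen q .cs) + u₂ * -(qc q • (gen q .cs * gen q .cs))
      + u₃ * (gen q .as * gen q .as) = r₂)
    (hr₃ : u₁ * ((qc q + (qc q)⁻¹) • (gen q .c * gen q .cs) - algebraMap ℂ _ (qc q)⁻¹)
      + u₂ * ((qc q + (qc q)⁻¹) • (gen q .a * gen q .cs))
      + u₃ * ((qc q + (qc q)⁻¹) • (gen q .c * gen q .as)) = r₃) :
    inc q (x * r₁) * omega q minus + inc q (x * r₂) * omega q plus + inc q (x * r₃) * omega q zero
      ∈ OmegaS q := by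
  have h := sum_mul_diff_mem hx h₁ h₂ h₃
  rw [sum_mul_diff] at h
  simp only [mul_assoc x, ← mul_add, hr₁, hr₂, hr₃] at h
  exact h

set_option linter.unusedSimpArgs false in
theorem inc_mul_omega_minus_mem {x : SUq q} (hx : x ∈ weight q (-1)) :
    inc q x * omega q minus ∈ OmegaS q := by
  have h0 := qc_ne_zero q
  -- A row of the left inverse of the coefficient matrix of the three differentials: each `u_i` is a
  -- scalar multiple of the adjoint of the coefficient of `ω_-`.
  have h := mem_OmegaS_of_sum_mul_diff (n := 1) (x := x)
    (u₁ := -(1 + qc q ^ 2) • (gen q .as * gen q .cs))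
    (u₂ := (-1 : ℂ) • (gen q .as * gen q .as)) (u₃ := (qc q)⁻¹ • (gen q .cs * gen q .cs))
    (r₁ := 1) (r₂ := 0) (r₃ := 0) (by simpa using hx) (Submodule.smul_mem _ _ (mul_mem_weight_one (by simp) (by simp)))
    (Submodule.smul_mem _ _ (mul_mem_weight_one (by simp) (by simp)))
    (Submodule.smul_mem _ _ (mul_mem_weight_one (by simp) (by simp))) ?_ ?_ ?_
  · simpa using h
  all_goals
    simp only [mul_add, mul_sub, smul_mul_assoc, mul_smul_comm, mul_assoc, mul_neg, smul_sub, smul_neg,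
      smul_smul, mul_one, one_mul, neg_mul, sub_mul, add_mul, Algebra.algebraMap_eq_smul_one,
      (gen_respects q).c_as, (gen_respects q).cs_as, ← (gen_respects q).c_cs, c_mul_a, cs_mul_a,
      as_mul_a, a_mul_as, c_mul_a_mul, cs_mul_a_mul, c_mul_as_mul, cs_mul_as_mul, cs_mul_c_mul,
      as_mul_a_mul, a_mul_as_mul]
    match_scalars <;> field_simp <;> ring

set_option linter.unusedSimpArgs false in
theorem inc_mul_omega_plus_mem {x : SUq q} (hx : x ∈ weight q 1) :
    inc q x * omega q plus ∈ OmegaS q := by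
  have h0 := qc_ne_zero q
  -- Scalar multiples of the adjoints of the coefficients of `ω_+`.
  have h := mem_OmegaS_of_sum_mul_diff (n := -1) (x := x)
    (u₁ := (qc q ^ 2 + qc q ^ 4) • (gen q .c * gen q .a))
    (u₂ := -(qc q ^ 3) • (gen q .c * gen q .c)) (u₃ := (1 : ℂ) • (gen q .a * gen q .a))
    (r₁ := 0) (r₂ := 1) (r₃ := 0) (by simpa using hx) (Submodule.smul_mem _ _ (mul_mem_weight_neg_one (by simp) (by simp)))
    (Submodule.smul_mem _ _ (mul_mem_weight_neg_one (by simp) (by simp)))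
    (Submodule.smul_mem _ _ (mul_mem_weight_neg_one (by simp) (by simp))) ?_ ?_ ?_
  · simpa using h
  all_goals
    simp only [mul_add, mul_sub, smul_mul_assoc, mul_smul_comm, mul_assoc, mul_neg, smul_sub, smul_neg,
      smul_smul, mul_one, one_mul, neg_mul, sub_mul, add_mul, Algebra.algebraMap_eq_smul_one,
      (gen_respects q).c_as, (gen_respects q).cs_as, ← (gen_respects q).c_cs, c_mul_a, cs_mul_a,
      as_mul_a, a_mul_as, c_mul_a_mul, cs_mul_a_mul, c_mul_as_mul, cs_mul_as_mul, cs_mul_c_mul,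
      as_mul_a_mul, a_mul_as_mul]
    match_scalars <;> field_simp <;> ring

set_option linter.unusedSimpArgs false in
theorem inc_mul_omega_zero_mem {x : SUq q} (hx : x ∈ weight q 0) :
    inc q x * omega q zero ∈ OmegaS q := by
  have h0 := qc_ne_zero q
  -- Scalar multiples of the adjoints of the coefficients of `ω_0`.
  have h := mem_OmegaS_of_sum_mul_diff (n := 0) (x := x)
    (u₁ := (qc q ^ 2) • ((qc q + (qc q)⁻¹) • (gen q .c * gen q .cs) - algebraMap ℂ _ (qc q)⁻¹))
    (u₂ := qc q • (gen q .c * gen q .as)) (u₃ := (qc q)⁻¹ • (gen q .a * gen q .cs))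
    (r₁ := 0) (r₂ := 0) (r₃ := 1) (by simpa using hx) (Submodule.smul_mem _ _ (sub_mem (Submodule.smul_mem _ _ c_cs_mem) (by simp [mem_weight])))
    (Submodule.smul_mem _ _ c_as_mem)
    (Submodule.smul_mem _ _ a_cs_mem) ?_ ?_ ?_
  · simpa using h
  all_goals
    simp only [mul_add, mul_sub, smul_mul_assoc, mul_smul_comm, mul_assoc, mul_neg, smul_sub, smul_neg,
      smul_smul, mul_one, one_mul, neg_mul, sub_mul, add_mul, Algebra.algebraMap_eq_smul_one,
      (gen_respects q).c_as, (gen_respects q).cs_as, ← (gen_respects q).c_cs, c_mul_a, cs_mul_a,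
      as_mul_a, a_mul_as, c_mul_a_mul, cs_mul_a_mul, c_mul_as_mul, cs_mul_as_mul, cs_mul_c_mul,
      as_mul_a_mul, a_mul_as_mul]
    match_scalars <;> field_simp <;> ring

end QSphere

end

/-! ### The sphere calculus contains all of `sphereForms`; components, integral and faithfulness. -/

noncomputable section

namespace QSphere

variable {q : Set.Ioo (0 : ℝ) 1}

open Form

theorem omega_zero_mem : omega q zero ∈ OmegaS q := by
  have h := inc_mul_omega_zero_mem (q := q) (x := 1) (by simp [mem_weight])
  simpa using h

/-- The coefficient of `ω_+` in the identity behind `inc_mul_omega_plus_mem`. It writes `1` as a sum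
of products of an element of weight `-1` and one of weight `1`. -/
theorem weight_one_decomposition : (qc q ^ 2 + qc q ^ 4) •
      ((gen q .c * gen q .a) * (gen q .as * gen q .cs))
    + qc q ^ 4 • ((gen q .c * gen q .c) * (gen q .cs * gen q .cs))
    + (gen q .a * gen q .a) * (gen q .as * gen q .as) = 1 := by
  have h0 := qc_ne_zero q
  simp only [mul_sub, mul_smul_comm, mul_assoc, smul_sub, smul_smul, (gen_respects q).cs_as,
    a_mul_as, c_mul_as_mul, cs_mul_c_mul, a_mul_as_mul]
  match_scalars <;> field_simp <;> ring

theorem inc_mul_omega_plus_zero_mem {x : SUq q} (hx : x ∈ weight q 1) :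
    inc q x * omega q plus * omega q zero ∈ OmegaS q :=
  mul_mem (inc_mul_omega_plus_mem hx) omega_zero_mem

/-- For `v`, `w` of weights `-1`, `1`, the product `(x v ω_-)(w ω_+)` equals `x v w ω_- ω_+` minus a
multiple of `ω_+ ω_0` already known to lie in the calculus. Summing over the decomposition of `1`
removes the factor `v w`. -/
theorem inc_mul_omega_minus_plus_mem {x : SUq q} (hx : x ∈ weight q 0) :
    inc q x * omega q minus * omega q plus ∈ OmegaS q := by
  have key {v w : SUq q} (hv : v ∈ weight q (-1)) (hw : w ∈ weight q 1) :
      inc q (x * (v * w)) * omega q minus * omega q plus ∈ OmegaS q := by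
    have h1 : inc q (x * v) * omega q minus * (inc q w * omega q plus) ∈ OmegaS q :=
      mul_mem (inc_mul_omega_minus_mem (mul_mem_weight hx hv rfl)) (inc_mul_omega_plus_mem hw)
    have h2 : inc q (x * v * fmat q minus zero w) * omega q plus * omega q zero ∈ OmegaS q :=
      inc_mul_omega_plus_zero_mem
        (mul_mem_weight (mul_mem_weight hx hv rfl) (fmat_minus_zero_mem hw rfl) rfl)
    have h3 : inc q w * omega q plus = formOf 0 0 w 0 0 0 0 0 := by simp [formOf]
    rw [h3, mul_assoc, omega_minus_mul_formOf, inc_mul_formOf] at h1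
    have h4 := add_mem h1 h2
    simpa [formOf, mul_assoc] using h4
  have hm {g g' : Gen} (hg : g = .a ∨ g = .c) (hg' : g' = .a ∨ g' = .c) :=
    mul_mem_weight_neg_one (q := q) hg hg'
  have hp {g g' : Gen} (hg : g = .as ∨ g = .cs) (hg' : g' = .as ∨ g' = .cs) :=
    mul_mem_weight_one (q := q) hg hg'
  have h1 := Subalgebra.smul_mem _ (key (hm (g := .c) (g' := .a) (by simp) (by simp))
    (hp (g := .as) (g' := .cs) (by simp) (by simp))) (qc q ^ 2 + qc q ^ 4)
  have h2 := Subalgebra.smul_mem _ (key (hm (g := .c) (g' := .c) (by simp) (by simp))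
    (hp (g := .cs) (g' := .cs) (by simp) (by simp))) (qc q ^ 4)
  have h3 := key (hm (g := .a) (g' := .a) (by simp) (by simp))
    (hp (g := .as) (g' := .as) (by simp) (by simp))
  have h4 := add_mem (add_mem h1 h2) h3
  have e : (qc q ^ 2 + qc q ^ 4) • (x * ((gen q .c * gen q .a) * (gen q .as * gen q .cs)))
      + qc q ^ 4 • (x * ((gen q .c * gen q .c) * (gen q .cs * gen q .cs)))
      + x * ((gen q .a * gen q .a) * (gen q .as * gen q .as)) = x := by
    rw [← mul_smul_comm _ x, ← mul_smul_comm _ x, ← mul_add, ← mul_add, weight_one_decomposition,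
      mul_one]
  rw [← smul_mul_assoc, ← smul_mul_assoc, ← smul_mul_assoc, ← smul_mul_assoc, ← add_mul, ← add_mul,
    ← add_mul, ← add_mul, ← map_smul, ← map_smul, ← map_add, ← map_add, e] at h4
  exact h4

theorem sphereForms_le_OmegaS : sphereForms q ≤ Subalgebra.toSubmodule (OmegaS q) := by
  rintro _ ⟨x₀, h0, x₁, h1, x₂, h2, x₃, h3, y₁, h4, y₂, h5, y₃, h6, t, h7, rfl⟩
  change _ ∈ OmegaS q
  exact add_mem (add_mem (add_mem (inc_mem_OmegaS h0)
    (add_mem (add_mem (inc_mul_omega_minus_mem h1) (inc_mul_omega_plus_mem h2))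
      (inc_mul_omega_zero_mem h3)))
    (add_mem (add_mem (inc_mul_omega_minus_plus_mem h4)
      (mul_mem (inc_mul_omega_minus_mem h5) omega_zero_mem)) (inc_mul_omega_plus_zero_mem h6)))
    (mul_mem (inc_mul_omega_minus_plus_mem h7) omega_zero_mem)

/-! ### Homogeneous components -/

/-- The component of degree `k` of `formOf`. -/
def formOfDeg (x₀ x₁ x₂ x₃ y₁ y₂ y₃ t : SUq q) : ℕ → OmegaSU q
  | 0 => formOf x₀ 0 0 0 0 0 0 0
  | 1 => formOf 0 x₁ x₂ x₃ 0 0 0 0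
  | 2 => formOf 0 0 0 0 y₁ y₂ y₃ 0
  | 3 => formOf 0 0 0 0 0 0 0 t
  | _ => 0

theorem sum_formOfDeg (x₀ x₁ x₂ x₃ y₁ y₂ y₃ t : SUq q) :
    ∑ k ∈ Finset.range 4, formOfDeg x₀ x₁ x₂ x₃ y₁ y₂ y₃ t k
      = formOf x₀ x₁ x₂ x₃ y₁ y₂ y₃ t := by
  simp [Finset.sum_range_succ, formOfDeg, formOf_add]

theorem formOfDeg_mem_formsSU (x₀ x₁ x₂ x₃ y₁ y₂ y₃ t : SUq q) (k : ℕ) :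
    formOfDeg x₀ x₁ x₂ x₃ y₁ y₂ y₃ t k ∈ formsSU q k := by
  have h0 (x : SUq q) := inc_mem_formsSU x
  have h1 (x : SUq q) (a : Form) := mul_omega_mem_formsSU (h0 x) a
  have h2 (x : SUq q) (a b : Form) := mul_omega_mem_formsSU (h1 x a) b
  have h3 (x : SUq q) (a b d : Form) := mul_omega_mem_formsSU (h2 x a b) d
  match k with
  | 0 => simpa [formOfDeg, formOf] using h0 x₀
  | 1 => simpa [formOfDeg, formOf] using add_mem (add_mem (h1 x₁ _) (h1 x₂ _)) (h1 x₃ _)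
  | 2 => simpa [formOfDeg, formOf] using add_mem (add_mem (h2 y₁ _ _) (h2 y₂ _ _)) (h2 y₃ _ _)
  | 3 => simpa [formOfDeg, formOf] using h3 t _ _ _
  | _ + 4 => exact zero_mem _

theorem formOfDeg_mem_OmegaS {x₀ x₁ x₂ x₃ y₁ y₂ y₃ t : SUq q} (h0 : x₀ ∈ weight q 0)
    (h1 : x₁ ∈ weight q (-1)) (h2 : x₂ ∈ weight q 1) (h3 : x₃ ∈ weight q 0)
    (h4 : y₁ ∈ weight q 0) (h5 : y₂ ∈ weight q (-1)) (h6 : y₃ ∈ weight q 1)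
    (h7 : t ∈ weight q 0) (k : ℕ) : formOfDeg x₀ x₁ x₂ x₃ y₁ y₂ y₃ t k ∈ OmegaS q := by
  have z (n : ℤ) : (0 : SUq q) ∈ weight q n := zero_mem _
  match k with
  | 0 => exact sphereForms_le_OmegaS ⟨_, h0, _, z _, _, z _, _, z _, _, z _, _, z _, _, z _, _, z _, rfl⟩
  | 1 => exact sphereForms_le_OmegaS ⟨_, z _, _, h1, _, h2, _, h3, _, z _, _, z _, _, z _, _, z _, rfl⟩
  | 2 => exact sphereForms_le_OmegaS ⟨_, z _, _, z _, _, z _, _, z _, _, h4, _, h5, _, h6, _, z _, rfl⟩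
  | 3 => exact sphereForms_le_OmegaS ⟨_, z _, _, z _, _, z _, _, z _, _, z _, _, z _, _, z _, _, h7, rfl⟩
  | _ + 4 => exact zero_mem _

theorem exists_eq_formOfDeg {k : ℕ} (hk : k ≤ 3) {θ : OmegaSU q} (hθ : θ ∈ OmegaS q)
    (h : θ ∈ formsSU q k) : ∃ x₀ ∈ weight q 0, ∃ x₁ ∈ weight q (-1), ∃ x₂ ∈ weight q 1,
    ∃ x₃ ∈ weight q 0, ∃ y₁ ∈ weight q 0, ∃ y₂ ∈ weight q (-1), ∃ y₃ ∈ weight q 1,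
    ∃ t ∈ weight q 0, θ = formOfDeg x₀ x₁ x₂ x₃ y₁ y₂ y₃ t k := by
  obtain ⟨x₀, h0, x₁, h1, x₂, h2, x₃, h3, y₁, h4, y₂, h5, y₃, h6, t, h7, rfl⟩ :=
    OmegaS_le_sphereForms hθ
  refine ⟨x₀, h0, x₁, h1, x₂, h2, x₃, h3, y₁, h4, y₂, h5, y₃, h6, t, h7, ?_⟩
  have h8 := formsSU_le_homogeneous k h
  rw [← sum_formOfDeg] at h8 ⊢
  exact eq_of_homogeneous_sum (by omega)
    (fun i _ => formsSU_le_homogeneous i (formOfDeg_mem_formsSU _ _ _ _ _ _ _ _ i)) h8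

/-! ## The integral -/

theorem formOf_top (t : SUq q) {m : ℝ} (hm : m ≠ 0) :
    formOf 0 0 0 0 0 0 0 t = inc q ((m : ℂ)⁻¹ • t) * volumeForm q m := by
  have hm' : (m : ℂ) ≠ 0 := Complex.ofReal_ne_zero.2 hm
  rw [volumeForm, mul_smul_comm, map_smul, smul_mul_assoc, smul_smul, mul_inv_cancel₀ hm', one_smul]
  simp only [formOf, map_zero, zero_mul, zero_add, add_zero, mul_assoc]

theorem inc_mul_volumeForm (f : SUq q) (m : ℝ) :
    inc q f * volumeForm q m = formOf 0 0 0 0 0 0 0 ((m : ℂ) • f) := by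
  rw [volumeForm, mul_smul_comm, ← smul_mul_assoc, ← map_smul]
  simp only [formOf, map_zero, zero_mul, zero_add, add_zero, mul_assoc]

theorem mem_top_iff {m : ℝ} (hm : m ≠ 0) (θ : OmegaSU q) :
    (∃ h : θ ∈ OmegaS q, (⟨θ, h⟩ : OmegaS q) ∈ formsS q 3) ↔
      ∃ f ∈ sphere q, θ = inc q f * volumeForm q m := by
  have z (n : ℤ) : (0 : SUq q) ∈ weight q n := zero_mem _
  constructor
  · rintro ⟨h, h'⟩
    obtain ⟨x₀, h0, x₁, h1, x₂, h2, x₃, h3, y₁, h4, y₂, h5, y₃, h6, t, h7, rfl⟩ :=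
      exists_eq_formOfDeg le_rfl h h'
    exact ⟨(m : ℂ)⁻¹ • t, mem_sphere.2 (Submodule.smul_mem _ _ h7), formOf_top t hm⟩
  · rintro ⟨f, hf, rfl⟩
    rw [inc_mul_volumeForm]
    exact ⟨formOfDeg_mem_OmegaS (z _) (z _) (z _) (z _) (z _) (z _) (z _)
      (Submodule.smul_mem _ _ (mem_sphere.1 hf)) 3,
      formOfDeg_mem_formsSU 0 0 0 0 0 0 0 ((m : ℂ) • f) 3⟩

/-- The integral for the volume form `m ω_- ∧ ω_+ ∧ ω_0`. -/
def integral (q : Set.Ioo (0 : ℝ) 1) (m : ℝ) : OmegaS q →ₗ[ℂ] ℂ :=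
  (m : ℂ)⁻¹ • (haar q ∘ₗ topPart q ∘ₗ (OmegaS q).val.toLinearMap)

theorem integral_apply (m : ℝ) (θ : OmegaS q) :
    integral q m θ = (m : ℂ)⁻¹ * haar q (topPart q θ) := rfl

theorem isIntegral_integral {m : ℝ} (hm : m ≠ 0) : IsIntegral q m (integral q m) where
  lower k hk θ hθ := by
    have h : topPart q (θ : OmegaSU q) = 0 := topPart_of_mem_formsSU hk hθ
    rw [integral_apply, h, map_zero, mul_zero]
  top f hf θ hθ := by
    have hm' : (m : ℂ) ≠ 0 := Complex.ofReal_ne_zero.2 hm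
    rw [integral_apply, hθ, inc_mul_volumeForm, topPart_formOf, map_smul, smul_eq_mul,
      inv_mul_cancel_left₀ hm']

/-- The homogeneous components of a form on the sphere are again forms on the sphere, so the two
prescriptions determine the functional everywhere. -/
theorem IsIntegral.eq_integral {m : ℝ} (hm : m ≠ 0) {I : OmegaS q →ₗ[ℂ] ℂ}
    (hI : IsIntegral q m I) : I = integral q m := by
  ext ⟨θ, hθ⟩
  obtain ⟨x₀, h0, x₁, h1, x₂, h2, x₃, h3, y₁, h4, y₂, h5, y₃, h6, t, h7, rfl⟩ :=
    OmegaS_le_sphereForms hθ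
  let η (k : ℕ) : OmegaS q := ⟨_, formOfDeg_mem_OmegaS h0 h1 h2 h3 h4 h5 h6 h7 k⟩
  have h : (⟨_, hθ⟩ : OmegaS q) = ∑ k ∈ Finset.range 4, η k := by
    apply Subtype.ext
    rw [AddSubmonoidClass.coe_finsetSum]
    exact (sum_formOfDeg ..).symm
  have hη (k : ℕ) : η k ∈ formsS q k := formOfDeg_mem_formsSU x₀ x₁ x₂ x₃ y₁ y₂ y₃ t k
  have hJ := isIntegral_integral (q := q) hm
  have htop : ((η 3 : OmegaS q) : OmegaSU q) = inc q ((m : ℂ)⁻¹ • t) * volumeForm q m :=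
    formOf_top t hm
  have hs : (m : ℂ)⁻¹ • t ∈ sphere q := mem_sphere.2 (Submodule.smul_mem _ _ h7)
  rw [h]
  simp only [Finset.sum_range_succ, Finset.sum_range_zero, map_add, zero_add]
  rw [hI.lower 0 (by norm_num) _ (hη 0), hI.lower 1 (by norm_num) _ (hη 1),
    hI.lower 2 (by norm_num) _ (hη 2), hJ.lower 0 (by norm_num) _ (hη 0),
    hJ.lower 1 (by norm_num) _ (hη 1), hJ.lower 2 (by norm_num) _ (hη 2),
    hI.top _ hs _ htop, hJ.top _ hs _ htop]

/-- Moving `ω_0` past a coefficient applies `K²`, which on a given weight is only a nonzero scalar.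
-/
theorem eq_zero_of_fmat_zero_zero {n : ℤ} {y : SUq q} (hy : y ∈ weight q n)
    (h : ∀ x ∈ weight q (-n), haar q (x * fmat q zero zero y) = 0) : y = 0 := by
  have h1 := haar_nondegenerate_weight (fmat_zero_zero_mem hy) h
  rw [fmat_zero_zero_apply hy] at h1
  exact (smul_eq_zero.1 h1).resolve_left
    (mul_ne_zero (zpow_ne_zero _ (qc_ne_zero q)) (zpow_ne_zero _ (qc_ne_zero q)))

theorem leftFaithful_integral {m : ℝ} (hm : m ≠ 0) : LeftFaithful q (integral q m) := by
  have hm' : (m : ℂ)⁻¹ ≠ 0 := inv_ne_zero (Complex.ofReal_ne_zero.2 hm)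
  have z (n : ℤ) : (0 : SUq q) ∈ weight q n := zero_mem _
  rintro k hk ⟨η, hη⟩ hηk hpair
  have hp {θ : OmegaSU q} (h : θ ∈ OmegaS q) (h' : θ ∈ formsSU q (3 - k)) :
      haar q (topPart q (θ * η)) = 0 := by
    have := hpair ⟨θ, h⟩ h'
    rw [integral_apply] at this
    exact (mul_eq_zero.1 this).resolve_left hm'
  obtain ⟨x₀, h0, x₁, h1, x₂, h2, x₃, h3, y₁, h4, y₂, h5, y₃, h6, t, h7, rfl⟩ :=
    exists_eq_formOfDeg hk hη hηk
  have g0 (x : SUq q) := inc_mem_formsSU x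
  have g1 (x : SUq q) (a : Form) := mul_omega_mem_formsSU (g0 x) a
  have g2 (x : SUq q) (a b : Form) := mul_omega_mem_formsSU (g1 x a) b
  have g3 (x : SUq q) (a b d : Form) := mul_omega_mem_formsSU (g2 x a b) d
  apply Subtype.ext
  change formOfDeg x₀ x₁ x₂ x₃ y₁ y₂ y₃ t k = 0
  interval_cases k
  · have e : x₀ = 0 := eq_zero_of_fmat_zero_zero h0 fun x hx => by
      have := hp (mul_mem (inc_mul_omega_minus_plus_mem (by simpa using hx)) omega_zero_mem)
        (g3 x _ _ _)
      simpa [formOfDeg, mul_assoc, omega_zero_mul_formOf, omega_plus_mul_formOf,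
        omega_minus_mul_formOf, inc_mul_formOf, topPart_formOf] using this
    simp [formOfDeg, e, formOf]
  · have e2 : x₂ = 0 := eq_zero_of_fmat_zero_zero h2 fun x hx => by
      have := hp (mul_mem (inc_mul_omega_minus_mem hx) omega_zero_mem) (g2 x _ _)
      simpa [formOfDeg, mul_assoc, omega_zero_mul_formOf, omega_plus_mul_formOf,
        omega_minus_mul_formOf, inc_mul_formOf, topPart_formOf] using this
    have e1 : x₁ = 0 := eq_zero_of_fmat_zero_zero h1 fun x hx => by
      have := hp (inc_mul_omega_plus_zero_mem hx) (g2 x _ _)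
      simpa [formOfDeg, mul_assoc, omega_zero_mul_formOf, omega_plus_mul_formOf,
        omega_minus_mul_formOf, inc_mul_formOf, topPart_formOf] using this
    -- Multiplying by `ω_- ω_+` also produces `f_{-0} ▷ x₁` and `f_{+0} ▷ x₂`, so `x₃` is isolated
    -- only after `x₁` and `x₂` are known to vanish.
    have e3 : x₃ = 0 := haar_nondegenerate_weight h3 fun x hx => by
      have := hp (inc_mul_omega_minus_plus_mem (by simpa using hx)) (g2 x _ _)
      simpa [formOfDeg, e1, e2, mul_assoc, omega_zero_mul_formOf, omega_plus_mul_formOf,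
        omega_minus_mul_formOf, inc_mul_formOf, topPart_formOf] using this
    simp [formOfDeg, e1, e2, e3, formOf]
  · have e1 : y₁ = 0 := eq_zero_of_fmat_zero_zero h4 fun x hx => by
      have := hp (inc_mul_omega_zero_mem (by simpa using hx)) (g1 x _)
      simpa [formOfDeg, mul_assoc, omega_zero_mul_formOf, omega_plus_mul_formOf,
        omega_minus_mul_formOf, inc_mul_formOf, topPart_formOf] using this
    -- Multiplying by `ω_+` gives `f_{+0} ▷ y₁ - y₂`, and by `ω_-` gives `f_{-0} ▷ y₁ + y₃`; this is
    -- why `y₁` comes first.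
    have e2 : y₂ = 0 := haar_nondegenerate_weight h5 fun x hx => by
      have := hp (inc_mul_omega_plus_mem hx) (g1 x _)
      simpa [formOfDeg, e1, mul_assoc, omega_zero_mul_formOf, omega_plus_mul_formOf,
        omega_minus_mul_formOf, inc_mul_formOf, topPart_formOf] using this
    have e3 : y₃ = 0 := haar_nondegenerate_weight h6 fun x hx => by
      have := hp (inc_mul_omega_minus_mem hx) (g1 x _)
      simpa [formOfDeg, e1, mul_assoc, omega_zero_mul_formOf, omega_plus_mul_formOf,
        omega_minus_mul_formOf, inc_mul_formOf, topPart_formOf] using this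
    simp [formOfDeg, e1, e2, e3, formOf]
  · have e : t = 0 := haar_nondegenerate_weight h7 fun x hx => by
      have := hp (inc_mem_OmegaS (by simpa using hx)) (g0 x)
      simpa [formOfDeg, inc_mul_formOf, topPart_formOf] using this
    simp [formOfDeg, e, formOf]

end QSphere

end

theorem lemma4p2 (q : Set.Ioo (0 : ℝ) 1) (m : ℝ) (hm : m ≠ 0) :
    (∀ θ : QSphere.OmegaSU q,
      (∃ h : θ ∈ QSphere.OmegaS q, (⟨θ, h⟩ : QSphere.OmegaS q) ∈ QSphere.formsS q 3) ↔
        ∃ f ∈ QSphere.sphere q, θ = QSphere.inc q f * QSphere.volumeForm q m) ∧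
    (∃! I : QSphere.OmegaS q →ₗ[ℂ] ℂ, QSphere.IsIntegral q m I) ∧
    ∀ I : QSphere.OmegaS q →ₗ[ℂ] ℂ, QSphere.IsIntegral q m I → QSphere.LeftFaithful q I :=
  ⟨QSphere.mem_top_iff hm,
    ⟨QSphere.integral q m, QSphere.isIntegral_integral hm, fun _ hI => hI.eq_integral hm⟩,
    fun _ hI => by rw [hI.eq_integral hm]; exact QSphere.leftFaithful_integral hm⟩
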